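/- **Theorem (Pathwise master equation).** *Setting.* Fix $d\ge 1$ and a refining sequence $(\mathbb T_n)_{n\in\mathbb N}$ of partitions of $[0,\infty)$: $\mathbb T_n=\{t_0,t_1,\dots\}$ with $0=t_0<t_1<\cdots$ and $t_k\to\infty$, $\mathbb T_1\subset\mathbb T_2\subset\cdots$, and the mesh of $\mathbb T_n$ tends to zero on each compact interval. For $s\in\mathbb T_n$ let $s'$ be its successor in $\mathbb T_n$. A continuous path $X:[0,\infty)\to\mathbb R^d$ belongs to $QV^d$ if for all $i,j$ and $t\ge 0$ the finite limit $$[X_i,X_j](t):=\lim_{n\to\infty}\sum_{s\in\mathbb T_n,\,s\le t}\big(X_i(s')-X_i(s)\big)\big(X_j(s')-X_j(s)\big)$$ exists and $t\mapsto[X_i,X_j](t)$ is continuous. The Föllmer integral is $\int_0^T\xi\,dX:=\lim_{n}\sum_{s\in\mathbb T_n,\,s\le T}\xi(s)\cdot(X(s')-X(s))$, whenever the limit exists. For open $U\subset\mathbb R^d$, $V\subset\mathbb R^n$, the class $C^{2,1}(U,V)$ consists of the functions $f:U\times V\to\mathbb R$ that are continuously differentiable in $(x,a)$ and twice continuously differentiable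 in $x$, with the second derivatives $f_{x_i,x_j}$ continuous on $U\times V$. A function $\xi:[0,\infty)\to\mathbb R^d$ is an admissible integrand for $X$ if for each $T>0$ there are $n\in\mathbb N$, open sets $U\subset\mathbb R^d$, $V\subset\mathbb R^n$, a function $f\in C^{2,1}(U,V)$ and a continuous path $A:[0,T]\to V$ with components of bounded variation such that $X(t)\in U$ and $\xi(t)=\nabla_xf(X(t),A(t))$ for $0\le t\le T$. Let $r:[0,\infty)\to\mathbb R$ be measurable with $\int_0^T|r(s)|\,ds<\infty$ for all $T>0$ (the short rate), and let $S\in QV^d$ have strictly positive components (the price path). A portfolio for $S$ is an admissible integrand $\pi$ for $\log S=(\log S_1,\dots,\log S_d)$ with $\pi_1(t)+\cdots+\pi_d(t)=1$ for all $t$; its value with unit initial wealth is $$V^\pi(t)=\exp\Big(\int_0^t\frac{\pi(s)}{S(s)}\,dS(s)-\frac12\sum_{i,j=1}^d\int_0^t\frac{\pi_i(s)\pi_j(s)}{S_i(s)S_j(s)}\,d[S_i,S_j](s)+\int_0^t\Big(1-\sum_{i=1}^d\pi_i(s)\Big)r(s)\,ds\Big),$$ where $\pi/S$ is the componentwise quotient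 and the first integral is a Föllmer integral. Let $\mu_i(t)=S_i(t)/(S_1(t)+\cdots+S_d(t))$ be the market portfolio. Let $\Delta^d_+$ be the set of points of the standard simplex in $\mathbb R^d$ with strictly positive components, let $V\supset\Delta_+^d$ and $W\subset\mathbb R^m$ be open sets, $G\in C^{2,1}(V,W)$ strictly positive, and $A:[0,\infty)\to W$ a continuous path whose components are of bounded variation on compact intervals. The portfolio generated by $G$ is $$\pi_i(t)=\mu_i(t)+\mu_i(t)\frac{\partial}{\partial x_i}\log G(\mu(t),A(t))-\sum_{j=1}^d\mu_i(t)\mu_j(t)\frac{\partial}{\partial x_j}\log G(\mu(t),A(t)),\qquad 1\le i\le d.$$ *Assertion.* Both $\mu$ and $\pi$ are portfolios for $S$ whose values $V^\mu$ and $V^\pi$ are well defined (all the limits and integrals above exist); $\mu\in QV^d$; the (possibly signed) Radon measures on $[0,\infty)$ $$\mathfrak g(dt):=-\frac12\sum_{i,j=1}^d\frac{G_{x_i,x_j}(\mu(t),A(t))}{G(\mu(t),A(t))}\,d[\mu_i,\mu_j](t),\qquad \mathfrak h(dt):=-\sum_{k=1}^m\frac{G_{a_k}(\mu(t),A(t))}{G(\mu(t),A(t))}\,dA_k(t)$$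 are well defined; and for every $0\le T<\infty$ $$\log\Big(\frac{V^\pi(T)}{V^\mu(T)}\Big)=\log\Big(\frac{G(\mu(T),A(T))}{G(\mu(0),A(0))}\Big)+\mathfrak g([0,T])+\mathfrak h([0,T]).$$ -/

import Mathlib

open MeasureTheory Filter Topology Set
open scoped NNReal

namespace FollmerSPT

noncomputable section

/-! ### Refining sequences of partitions of `[0, ∞)` -/

/-- A refining sequence of partitions of `[0, ∞)`. The `n`-th partition is
`0 = point n 0 < point n 1 < ⋯`, and the successor of `point n k` is `point n (k + 1)`. -/
structure RefiningPartitions where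
  point : ℕ → ℕ → ℝ≥0
  point_zero : ∀ n, point n 0 = 0
  strictMono : ∀ n, StrictMono (point n)
  tendsto_atTop : ∀ n, Tendsto (point n) atTop atTop
  refining : ∀ n, range (point n) ⊆ range (point (n + 1))
  mesh : ∀ T : ℝ≥0, ∀ ε : ℝ, 0 < ε →
    ∀ᶠ n in atTop, ∀ k, point n k ≤ T → dist (point n (k + 1)) (point n k) < ε

namespace RefiningPartitions

variable (P : RefiningPartitions)

theorem finite_le (n : ℕ) (t : ℝ≥0) : {k : ℕ | P.point n k ≤ t}.Finite := by
  obtain ⟨N, hN⟩ := eventually_atTop.1 ((P.tendsto_atTop n).eventually (eventually_gt_atTop t))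
  refine (finite_lt_nat N).subset fun k hk => ?_
  by_contra h
  exact absurd (hN k (not_lt.1 h)) (not_lt.2 hk)

/-- The indices `k` of those points `s = point n k` of the `n`-th partition with `s ≤ t`. -/
def index (n : ℕ) (t : ℝ≥0) : Finset ℕ := (P.finite_le n t).toFinset

@[simp] theorem mem_index {n : ℕ} {t : ℝ≥0} {k : ℕ} :
    k ∈ P.index n t ↔ P.point n k ≤ t := by
  simp [index]

/-! ### Pathwise covariation -/

/-- `∑_{s ∈ 𝕋ₙ, s ≤ t} (X(s') - X(s)) (Y(s') - Y(s))`. -/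
def covSum (X Y : ℝ≥0 → ℝ) (n : ℕ) (t : ℝ≥0) : ℝ :=
  ∑ k ∈ P.index n t, (X (P.point n (k + 1)) - X (P.point n k)) *
    (Y (P.point n (k + 1)) - Y (P.point n k))

/-- The pathwise covariation `[X, Y](t)` (meaningful if the limit exists). -/
def covariation (X Y : ℝ≥0 → ℝ) (t : ℝ≥0) : ℝ :=
  limUnder atTop fun n => P.covSum X Y n t

/-- The class `QV^d`: continuous paths whose components have continuous pathwise covariations
along the given sequence of partitions. -/
structure QV {d : ℕ} (X : ℝ≥0 → Fin d → ℝ) : Prop where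
  continuous : Continuous X
  exists_limit : ∀ i j t, ∃ l : ℝ,
    Tendsto (fun n => P.covSum (fun s => X s i) (fun s => X s j) n t) atTop (𝓝 l)
  continuous_covariation : ∀ i j,
    Continuous (P.covariation (fun s => X s i) (fun s => X s j))

/-! ### The Föllmer integral -/

/-- `∑_{s ∈ 𝕋ₙ, s ≤ t} ξ(s) · (X(s') - X(s))`. -/
def follmerSum {d : ℕ} (ξ X : ℝ≥0 → Fin d → ℝ) (n : ℕ) (t : ℝ≥0) : ℝ :=
  ∑ k ∈ P.index n t, ∑ i, ξ (P.point n k) i * (X (P.point n (k + 1)) i - X (P.point n k) i)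

/-- The Föllmer integral `∫₀ᵗ ξ dX` (meaningful if the limit exists). -/
def follmerIntegral {d : ℕ} (ξ X : ℝ≥0 → Fin d → ℝ) (t : ℝ≥0) : ℝ :=
  limUnder atTop fun n => P.follmerSum ξ X n t

end RefiningPartitions

/-! ### Stieltjes integrals against continuous paths of locally bounded variation -/

open scoped Classical in
/-- The signed Stieltjes measure `dg` of a path `g` on the time interval `[0, T]`, i.e. the measure
of the path stopped at time `T` (for a continuous `g`, it gives mass `g b - g a` to `[a, b]` if
`a ≤ b ≤ T`). It is the zero measure if `g` is not of bounded variation on `[0, T]`. -/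
def stieltjesMeasure (g : ℝ≥0 → ℝ) (T : ℝ≥0) : SignedMeasure ℝ≥0 :=
  if h : BoundedVariationOn (fun t => g (min t T)) univ then h.vectorMeasure else 0

/-- `∫_{[0, T]} φ dg`. -/
def stieltjesIntegral (φ g : ℝ≥0 → ℝ) (T : ℝ≥0) : ℝ :=
  ((stieltjesMeasure g T).restrict (Icc 0 T)).integral φ (ContinuousLinearMap.lsmul ℝ ℝ)

/-- The signed Radon measure `φ dg` on `[0, ∞)` makes sense: `g` is continuous and of bounded
variation on compact intervals, and `φ` is integrable with respect to `dg` on each `[0, T]`. -/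
def StieltjesIntegrable (φ g : ℝ≥0 → ℝ) : Prop :=
  Continuous g ∧ LocallyBoundedVariationOn g univ ∧
    ∀ T, (stieltjesMeasure g T).IntegrableOn φ (Icc 0 T)

/-! ### Functions of class `C^{2,1}` -/

/-- The partial derivative `f_{x_i}`. -/
def partialX {d n : ℕ} (i : Fin d) (f : (Fin d → ℝ) → (Fin n → ℝ) → ℝ)
    (x : Fin d → ℝ) (a : Fin n → ℝ) : ℝ :=
  fderiv ℝ (fun y => f y a) x (Pi.single i 1)

/-- The partial derivative `f_{a_k}`. -/
def partialA {d n : ℕ} (k : Fin n) (f : (Fin d → ℝ) → (Fin n → ℝ) → ℝ)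
    (x : Fin d → ℝ) (a : Fin n → ℝ) : ℝ :=
  fderiv ℝ (fun b => f x b) a (Pi.single k 1)

/-- The class `C^{2,1}(U, V)`: continuously differentiable in `(x, a) ∈ U × V` and twice
continuously differentiable in `x ∈ U`, the second derivatives `f_{x_i x_j}` being continuous
on `U × V`. -/
structure IsC21 {d n : ℕ} (U : Set (Fin d → ℝ)) (V : Set (Fin n → ℝ))
    (f : (Fin d → ℝ) → (Fin n → ℝ) → ℝ) : Prop where
  contDiffOn_one : ContDiffOn ℝ 1 (fun p : (Fin d → ℝ) × (Fin n → ℝ) => f p.1 p.2) (U ×ˢ V)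
  contDiffOn_two : ∀ a ∈ V, ContDiffOn ℝ 2 (fun x => f x a) U
  continuousOn_second : ∀ i j, ContinuousOn
    (fun p : (Fin d → ℝ) × (Fin n → ℝ) => partialX j (partialX i f) p.1 p.2) (U ×ˢ V)

/-! ### Admissible integrands and portfolios -/

/-- `ξ` is an admissible integrand for `X`. -/
def IsAdmissible {d : ℕ} (ξ X : ℝ≥0 → Fin d → ℝ) : Prop :=
  ∀ T : ℝ≥0, 0 < T →
    ∃ (n : ℕ) (U : Set (Fin d → ℝ)) (V : Set (Fin n → ℝ))
      (f : (Fin d → ℝ) → (Fin n → ℝ) → ℝ) (A : ℝ≥0 → Fin n → ℝ),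
      IsOpen U ∧ IsOpen V ∧ IsC21 U V f ∧
      ContinuousOn A (Icc 0 T) ∧
      (∀ k, BoundedVariationOn (fun t => A t k) (Icc 0 T)) ∧
      ∀ t ∈ Icc 0 T, A t ∈ V ∧ X t ∈ U ∧ ∀ i, ξ t i = partialX i f (X t) (A t)

/-- The path `log S`. -/
def logPath {d : ℕ} (S : ℝ≥0 → Fin d → ℝ) : ℝ≥0 → Fin d → ℝ :=
  fun t i => Real.log (S t i)

/-- A portfolio for `S`. -/
structure IsPortfolio {d : ℕ} (S π : ℝ≥0 → Fin d → ℝ) : Prop where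
  admissible : IsAdmissible π (logPath S)
  sum_eq_one : ∀ t, ∑ i, π t i = 1

/-- The portfolio value `V^π` with unit initial wealth, for the price path `S` and the short
rate `r`. -/
def portfolioValue {d : ℕ} (P : RefiningPartitions) (r : ℝ≥0 → ℝ) (S π : ℝ≥0 → Fin d → ℝ)
    (t : ℝ≥0) : ℝ :=
  Real.exp (P.follmerIntegral (fun s i => π s i / S s i) S t
    - 1 / 2 * ∑ i, ∑ j, stieltjesIntegral (fun s => π s i * π s j / (S s i * S s j))
        (P.covariation (fun s => S s i) (fun s => S s j)) t
    + ∫ s in (0 : ℝ)..t, (1 - ∑ i, π s.toNNReal i) * r s.toNNReal)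

/-- All the limits and integrals in the definition of the portfolio value `V^π` exist. -/
structure ValueWellDefined {d : ℕ} (P : RefiningPartitions) (r : ℝ≥0 → ℝ)
    (S π : ℝ≥0 → Fin d → ℝ) : Prop where
  follmer : ∀ t, ∃ l : ℝ,
    Tendsto (fun n => P.follmerSum (fun s i => π s i / S s i) S n t) atTop (𝓝 l)
  stieltjes : ∀ i j, StieltjesIntegrable (fun s => π s i * π s j / (S s i * S s j))
    (P.covariation (fun s => S s i) (fun s => S s j))
  rate : ∀ t : ℝ≥0, IntervalIntegrable
    (fun s : ℝ => (1 - ∑ i, π s.toNNReal i) * r s.toNNReal) volume 0 t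

/-- The market portfolio `μ`. -/
def marketPortfolio {d : ℕ} (S : ℝ≥0 → Fin d → ℝ) : ℝ≥0 → Fin d → ℝ :=
  fun t i => S t i / ∑ j, S t j

/-- The set `Δ₊^d` of the points of the standard simplex with strictly positive components. -/
def openSimplex (d : ℕ) : Set (Fin d → ℝ) := stdSimplex ℝ (Fin d) ∩ {x | ∀ i, 0 < x i}

/-- The portfolio generated by the function `G`, with the market weights `μ` and the additional
path `A` as its arguments. -/
def generatedPortfolio {d m : ℕ} (G : (Fin d → ℝ) → (Fin m → ℝ) → ℝ)
    (μ : ℝ≥0 → Fin d → ℝ) (A : ℝ≥0 → Fin m → ℝ) : ℝ≥0 → Fin d → ℝ :=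
  fun t i => μ t i
    + μ t i * partialX i (fun x a => Real.log (G x a)) (μ t) (A t)
    - ∑ j, μ t i * μ t j * partialX j (fun x a => Real.log (G x a)) (μ t) (A t)

end

end FollmerSPT

/-!
The market weights are `μ = S / σ` with `σ = S₁ + ⋯ + S_d`. The proof compares discrete growth
factors instead of applying a pathwise Itô formula. Over a partition interval from `s` to `s'` put
`u = ∑ᵢ (πᵢ / Sᵢ)(s) ΔSᵢ`, which is the summand of the Föllmer integral in `V^π`, and
`γ = ∑ₖ (G_{x_k} / G)(s) Δμₖ`. For the generated portfolio the identity
`1 + u = (σ(s') / σ(s)) (1 + γ)` holds exactly (`one_add_sum_generatedPortfolio`).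

* The sums of `log (σ(s') / σ(s))` telescope.
* By Taylor's formula for `G`, `G(s') / G(s) = 1 + γ + δ` with
  `δ = 1/2 ∑ (G_{x_i x_j} / G) Δμᵢ Δμⱼ + ∑ (G_{a_k} / G) ΔAₖ` up to an error that is small relative
  to `|Δμ|² + |ΔA|` (`IsC21.eventually_abs_remainder_le`). Hence
  `log (1 + γ) = Δ log G - δ` up to negligible terms, and the sums of `log (1 + γ)` converge to
  `log (G(T) / G(0)) + 𝔤([0, T]) + 𝔥([0, T])` (`tendsto_sum_log_one_add_gradient`).
* Since `log (1 + u) = u - u² / 2` up to negligible terms and the sums of `u²` converge to the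
  correction term in `V^π`, the Föllmer integral exists and `log V^π(T)` is the limit of the sums of
  `log (1 + u)` (`tendsto_follmerSum_generatedPortfolio`).

The constant function `1` generates `μ`, so that `log V^μ(T) = log (σ(T) / σ(0))` is a special case,
and the master equation is the difference of the two.

The convergence of weighted sums of `ΔXᵢ ΔXⱼ` and of `ΔAₖ` to Stieltjes integrals is
`WeightedSumLimit.of_continuous`. The weights `μ` belong to `QV^d` because `Δμ` is, up to a factor
close to `1`, linear in `ΔS` with continuous coefficients (`qv_marketPortfolio`). Finally, `π` is an
admissible integrand because it is the gradient in `x = log S` of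
`log (∑ᵢ exp xᵢ) + log G(softmax x, a)`; the derivatives of this function that are needed are
handled by the closure properties of `IsPartialC1`.
-/

namespace FollmerSPT

/-! ### Sums along a refining sequence of partitions -/

namespace RefiningPartitions

variable (P : RefiningPartitions)

theorem exists_index_eq_range (n : ℕ) (t : ℝ≥0) :
    ∃ N, P.index n t = Finset.range (N + 1) ∧ P.point n N ≤ t ∧ t < P.point n (N + 1) := by
  have hex : ∃ k, t < P.point n k :=
    ((P.tendsto_atTop n).eventually (eventually_gt_atTop t)).exists
  classical
  obtain ⟨N, hN⟩ : ∃ N, Nat.find hex = N + 1 := by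
    refine Nat.exists_eq_succ_of_ne_zero fun h => ?_
    have := Nat.find_spec hex
    rw [h, P.point_zero] at this
    exact not_lt_bot this
  have h1 : t < P.point n (N + 1) := hN ▸ Nat.find_spec hex
  have h2 : P.point n N ≤ t := not_lt.1 (Nat.find_min hex (by omega))
  refine ⟨N, ?_, h2, h1⟩
  ext k
  rw [P.mem_index, Finset.mem_range]
  constructor
  · intro h
    exact (P.strictMono n).lt_iff_lt.1 (h.trans_lt h1)
  · intro h
    exact ((P.strictMono n).monotone (Nat.lt_succ_iff.1 h)).trans h2

theorem index_subset (n : ℕ) {s t : ℝ≥0} (h : s ≤ t) : P.index n s ⊆ P.index n t := by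
  intro k hk
  rw [P.mem_index] at hk ⊢
  exact hk.trans h

theorem index_zero (n : ℕ) : P.index n 0 = {0} := by
  obtain ⟨N, h, h0, -⟩ := P.exists_index_eq_range n 0
  have : N = 0 := by
    rw [← P.point_zero n] at h0
    exact Nat.le_zero.1 ((P.strictMono n).le_iff_le.1 h0)
  simp [h, this]

theorem point_le_succ (n k : ℕ) : P.point n k ≤ P.point n (k + 1) :=
  (P.strictMono n).monotone k.le_succ

theorem eventually_succ_le (T : ℝ≥0) :
    ∀ᶠ n in atTop, ∀ k ∈ P.index n T, P.point n (k + 1) ≤ T + 1 := by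
  filter_upwards [P.mesh T 1 one_pos] with n hn k hk
  rw [P.mem_index] at hk
  have h := hn k hk
  rw [NNReal.dist_eq] at h
  have h' := (abs_lt.1 h).2
  have hk' : (P.point n k : ℝ) ≤ T := hk
  rw [← NNReal.coe_le_coe]
  push_cast
  linarith

/-- The oscillation of a continuous path over the partition intervals starting before `T` tends
to zero. -/
theorem eventually_dist_le {E : Type*} [PseudoMetricSpace E] {Y : ℝ≥0 → E} (hY : Continuous Y)
    (T : ℝ≥0) {ε : ℝ} (hε : 0 < ε) :
    ∀ᶠ n in atTop, ∀ k ∈ P.index n T, ∀ s ∈ Icc (P.point n k) (P.point n (k + 1)),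
      dist (Y s) (Y (P.point n k)) ≤ ε := by
  have hu := (isCompact_Icc (a := (0 : ℝ≥0)) (b := T + 1)).uniformContinuousOn_of_continuous
    hY.continuousOn
  obtain ⟨δ, hδ, h⟩ := Metric.uniformContinuousOn_iff.1 hu ε hε
  filter_upwards [P.mesh T δ hδ, P.eventually_succ_le T] with n hn hn' k hk s hs
  have hk' := (P.mem_index.1 hk)
  refine (h s ⟨zero_le, hs.2.trans (hn' k hk)⟩ _ ⟨zero_le,
    (P.point_le_succ n k).trans (hn' k hk)⟩ ?_).le
  refine lt_of_le_of_lt ?_ (hn k hk')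
  have h1 : (P.point n k : ℝ) ≤ s := hs.1
  have h2 : (s : ℝ) ≤ P.point n (k + 1) := hs.2
  rw [NNReal.dist_eq, NNReal.dist_eq, abs_of_nonneg (by linarith), abs_of_nonneg (by linarith)]
  linarith

theorem eventually_abs_increment_le {Y : ℝ≥0 → ℝ} (hY : Continuous Y) (T : ℝ≥0) {ε : ℝ}
    (hε : 0 < ε) :
    ∀ᶠ n in atTop, ∀ k ∈ P.index n T, |Y (P.point n (k + 1)) - Y (P.point n k)| ≤ ε := by
  filter_upwards [P.eventually_dist_le hY T hε] with n hn k hk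
  rw [← Real.dist_eq]
  exact hn k hk _ (right_mem_Icc.2 (P.point_le_succ n k))

/-- The sums run over `s ≤ t` and so telescope to the successor of the last such `s`, which
converges to `t`. -/
theorem tendsto_sum_increment {Y : ℝ≥0 → ℝ} (hY : Continuous Y) (t : ℝ≥0) :
    Tendsto (fun n => ∑ k ∈ P.index n t, (Y (P.point n (k + 1)) - Y (P.point n k))) atTop
      (𝓝 (Y t - Y 0)) := by
  rw [Metric.tendsto_atTop']
  intro ε hε
  have hε' : 0 < ε / 4 := by positivity
  obtain ⟨M, hM⟩ := eventually_atTop.1 (P.eventually_dist_le hY t hε')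
  refine ⟨M, fun n hn => ?_⟩
  obtain ⟨N, h1, h2, h3⟩ := P.exists_index_eq_range n t
  have hN : N ∈ P.index n t := P.mem_index.2 h2
  have ha := hM n hn.le N hN t ⟨h2, h3.le⟩
  have hb := hM n hn.le N hN _ (right_mem_Icc.2 (P.point_le_succ n N))
  rw [h1, Finset.sum_range_sub (fun k => Y (P.point n k)), P.point_zero, Real.dist_eq]
  rw [Real.dist_eq] at ha hb
  rw [abs_lt]
  rw [abs_le] at ha hb
  constructor <;> linarith [ha.1, ha.2, hb.1, hb.2]

theorem eventually_sum_abs_increment_le {Y : ℝ≥0 → ℝ} (hY : LocallyBoundedVariationOn Y univ)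
    (T : ℝ≥0) :
    ∃ C : ℝ, ∀ᶠ n in atTop,
      ∑ k ∈ P.index n T, |Y (P.point n (k + 1)) - Y (P.point n k)| ≤ C := by
  have hfin : eVariationOn Y (univ ∩ Icc 0 (T + 1)) ≠ ⊤ := hY 0 (T + 1) trivial trivial
  refine ⟨(eVariationOn Y (univ ∩ Icc 0 (T + 1))).toReal, ?_⟩
  filter_upwards [P.eventually_succ_le T] with n hn
  obtain ⟨N, h1, h2, h3⟩ := P.exists_index_eq_range n T
  have hle := eVariationOn.sum_le_of_monotoneOn_Iic (f := Y) (s := univ ∩ Icc 0 (T + 1))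
    (n := N + 1) (u := P.point n) ((P.strictMono n).monotone.monotoneOn _) (fun i hi =>
      ⟨trivial, zero_le, ((P.strictMono n).monotone hi).trans (hn N (P.mem_index.2 h2))⟩)
  have := ENNReal.toReal_mono hfin hle
  rw [h1]
  refine le_trans (le_of_eq ?_) this
  rw [ENNReal.toReal_sum (fun i _ => edist_ne_top _ _)]
  refine Finset.sum_congr rfl fun k _ => ?_
  rw [← dist_edist, Real.dist_eq]

/-- Sums of terms that are uniformly small relative to terms with bounded sums tend to zero. -/
theorem tendsto_sum_zero_of_small {e b : ℕ → ℕ → ℝ} {T : ℝ≥0}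
    (he : ∀ ε > 0, ∀ᶠ n in atTop, ∀ k ∈ P.index n T, |e n k| ≤ ε * b n k)
    (hb : ∃ C : ℝ, ∀ᶠ n in atTop, ∑ k ∈ P.index n T, b n k ≤ C) :
    Tendsto (fun n => ∑ k ∈ P.index n T, e n k) atTop (𝓝 0) := by
  obtain ⟨C, hC⟩ := hb
  rw [Metric.tendsto_nhds]
  intro ε hε
  have hε' : 0 < ε / (2 * (|C| + 1)) := by positivity
  filter_upwards [he _ hε', hC] with n h1 h2
  rw [Real.dist_eq, sub_zero]
  calc |∑ k ∈ P.index n T, e n k| ≤ ∑ k ∈ P.index n T, |e n k| := Finset.abs_sum_le_sum_abs _ _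
    _ ≤ ∑ k ∈ P.index n T, ε / (2 * (|C| + 1)) * b n k := Finset.sum_le_sum h1
    _ = ε / (2 * (|C| + 1)) * ∑ k ∈ P.index n T, b n k := by rw [Finset.mul_sum]
    _ ≤ ε / (2 * (|C| + 1)) * (|C| + 1) := by
      gcongr
      exact h2.trans ((le_abs_self C).trans (by linarith))
    _ = ε / 2 := by field_simp
    _ < ε := by linarith

end RefiningPartitions

theorem locallyBoundedVariationOn_of_abs_sub_le {g h : ℝ≥0 → ℝ} (hh : Monotone h)
    (hgh : ∀ s t, s ≤ t → |g t - g s| ≤ h t - h s) : LocallyBoundedVariationOn g univ := by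
  intro a b ha hb
  have hb' := (hh.monotoneOn univ).locallyBoundedVariationOn a b ha hb
  refine ne_top_of_le_ne_top hb' ?_
  refine iSup_le fun p => le_trans (Finset.sum_le_sum fun i _ => ?_)
    (eVariationOn.sum_le (n := p.1) p.2.2.1 p.2.2.2)
  have hp := p.2.2.1 (Nat.le_succ i)
  rw [edist_dist, edist_dist, Real.dist_eq, Real.dist_eq]
  exact ENNReal.ofReal_le_ofReal ((hgh _ _ hp).trans (le_abs_self _))

/-! ### Stieltjes integrals as limits of weighted sums -/

section Stieltjes

variable {φ g : ℝ≥0 → ℝ}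

theorem boundedVariationOn_stopped (hg : LocallyBoundedVariationOn g univ) (T : ℝ≥0) :
    BoundedVariationOn (fun t => g (min t T)) univ := by
  have h : eVariationOn g (univ ∩ Icc 0 T) ≠ ⊤ := hg 0 T trivial trivial
  refine ne_top_of_le_ne_top h ?_
  refine eVariationOn.comp_le_of_monotoneOn g (fun t => min t T) ?_ ?_
  · intro a _ b _ hab
    exact min_le_min_right T hab
  · intro a _
    exact ⟨trivial, zero_le, min_le_right _ _⟩

theorem stieltjesMeasure_Icc (hg : Continuous g) (hbv : LocallyBoundedVariationOn g univ)
    {t T : ℝ≥0} (ht : t ≤ T) : stieltjesMeasure g T (Icc 0 t) = g t - g 0 := by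
  have h := boundedVariationOn_stopped hbv T
  have hc : Continuous fun t => g (min t T) := hg.comp (continuous_id.min continuous_const)
  rw [stieltjesMeasure, dif_pos h, h.vectorMeasure_Icc zero_le,
    ContinuousWithinAt.rightLim_eq hc.continuousAt.continuousWithinAt,
    ContinuousWithinAt.leftLim_eq hc.continuousAt.continuousWithinAt]
  simp [ht]

instance isFiniteMeasure_variation_stieltjesMeasure (g : ℝ≥0 → ℝ) (T : ℝ≥0) :
    IsFiniteMeasure (stieltjesMeasure g T).variation := by
  rw [← SignedMeasure.totalVariation_eq_variation]
  exact ⟨by simp [SignedMeasure.totalVariation]⟩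

theorem integrableOn_stieltjesMeasure (hφ : Continuous φ) (g : ℝ≥0 → ℝ) (T : ℝ≥0) :
    (stieltjesMeasure g T).IntegrableOn φ (Icc 0 T) := by
  rw [VectorMeasure.IntegrableOn, VectorMeasure.Integrable,
    VectorMeasure.variation_restrict measurableSet_Icc]
  exact hφ.continuousOn.integrableOn_compact isCompact_Icc

theorem StieltjesIntegrable.of_continuous (hφ : Continuous φ) (hg : Continuous g)
    (hbv : LocallyBoundedVariationOn g univ) : StieltjesIntegrable φ g :=
  ⟨hg, hbv, integrableOn_stieltjesMeasure hφ g⟩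

/-- The sums `∑_{s ∈ 𝕋ₙ, s ≤ T} φ(s) wₙ(s)` converge to `∫_{[0, T]} φ dg`. -/
def WeightedSumLimit (P : RefiningPartitions) (w : ℕ → ℕ → ℝ) (g : ℝ≥0 → ℝ) (T : ℝ≥0)
    (φ : ℝ≥0 → ℝ) : Prop :=
  (stieltjesMeasure g T).IntegrableOn φ (Icc 0 T) ∧
    Tendsto (fun n => ∑ k ∈ P.index n T, φ (P.point n k) * w n k) atTop
      (𝓝 (stieltjesIntegral φ g T))

namespace WeightedSumLimit

variable {P : RefiningPartitions} {w : ℕ → ℕ → ℝ} {T : ℝ≥0} {ψ : ℝ≥0 → ℝ}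

theorem add (h₁ : WeightedSumLimit P w g T φ) (h₂ : WeightedSumLimit P w g T ψ) :
    WeightedSumLimit P w g T (fun t => φ t + ψ t) := by
  refine ⟨Integrable.add h₁.1 h₂.1, ?_⟩
  rw [stieltjesIntegral, VectorMeasure.integral_fun_add h₁.1 h₂.1]
  refine (h₁.2.add h₂.2).congr fun n => ?_
  simp only [add_mul, Finset.sum_add_distrib]

theorem const_mul (c : ℝ) (h : WeightedSumLimit P w g T φ) :
    WeightedSumLimit P w g T (fun t => c * φ t) := by
  refine ⟨Integrable.const_mul h.1 c, ?_⟩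
  have := VectorMeasure.integral_fun_smul ((stieltjesMeasure g T).restrict (Icc 0 T))
    (ContinuousLinearMap.lsmul ℝ ℝ) c φ
  simp only [smul_eq_mul] at this
  rw [stieltjesIntegral, this]
  refine (h.2.const_mul c).congr fun n => ?_
  simp only [mul_assoc, Finset.mul_sum]

theorem indicator (hg : Continuous g) (hbv : LocallyBoundedVariationOn g univ)
    {t : ℝ≥0} (ht : t ≤ T)
    (hw : Tendsto (fun n => ∑ k ∈ P.index n t, w n k) atTop (𝓝 (g t - g 0))) :
    WeightedSumLimit P w g T ((Iic t).indicator fun _ => 1) := by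
  constructor
  · rw [VectorMeasure.IntegrableOn, VectorMeasure.Integrable,
      VectorMeasure.variation_restrict measurableSet_Icc]
    exact (integrable_const (1 : ℝ)).indicator measurableSet_Iic
  · have hI : Icc 0 T ∩ Iic t = Icc 0 t := by
      ext s
      simp only [mem_inter_iff, mem_Icc, mem_Iic]
      exact ⟨fun h => ⟨h.1.1, h.2⟩, fun h => ⟨⟨h.1, h.2.trans ht⟩, h.2⟩⟩
    rw [stieltjesIntegral, VectorMeasure.setIntegral_indicator measurableSet_Icc measurableSet_Iic,
      hI, VectorMeasure.setIntegral_const, stieltjesMeasure_Icc hg hbv ht]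
    simp only [ContinuousLinearMap.lsmul_apply, one_smul]
    refine hw.congr fun n => ?_
    rw [← Finset.sum_subset (P.index_subset n ht)]
    · refine Finset.sum_congr rfl fun k hk => ?_
      rw [indicator_of_mem (mem_Iic.2 (P.mem_index.1 hk)), one_mul]
    · intro k _ hk
      rw [P.mem_index] at hk
      rw [indicator_of_notMem (mem_Iic.not.2 hk), zero_mul]

/-- A continuous function is approximated by functions that are constant on the intervals
`(τ j, τ (j + 1)]`, for which the limit is that of the unweighted sums. -/
theorem exists_step (hg : Continuous g) (hbv : LocallyBoundedVariationOn g univ)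
    (hw : ∀ t ≤ T, Tendsto (fun n => ∑ k ∈ P.index n t, w n k) atTop (𝓝 (g t - g 0)))
    {τ : ℕ → ℝ≥0} (hτ : Monotone τ) (hτ0 : τ 0 = 0) (hτT : ∀ j, τ j ≤ T) {ε : ℝ} (hε : 0 ≤ ε)
    (hφ : ∀ j, ∀ t ∈ Icc (τ j) (τ (j + 1)), |φ t - φ (τ j)| ≤ ε) (N : ℕ) :
    ∃ ψ, WeightedSumLimit P w g T ψ ∧ (∀ t ≤ τ N, |φ t - ψ t| ≤ ε) ∧ ∀ t, τ N < t → ψ t = 0 := by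
  have hind : ∀ j, WeightedSumLimit P w g T ((Iic (τ j)).indicator fun _ => 1) := fun j =>
    indicator hg hbv (hτT j) (hw _ (hτT j))
  induction N with
  | zero =>
    refine ⟨_, (hind 0).const_mul (φ 0), fun t ht => ?_, fun t ht => ?_⟩
    · have h0 : t = 0 := le_antisymm (hτ0 ▸ ht) zero_le
      rw [indicator_of_mem (mem_Iic.2 ht), h0]
      simpa using hε
    · rw [indicator_of_notMem (by simpa using ht), mul_zero]
  | succ N ih =>
    obtain ⟨ψ, h1, h2, h3⟩ := ih
    have hle := hτ N.le_succ
    refine ⟨_, (h1.add ((hind (N + 1)).const_mul (φ (τ N)))).add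
      ((hind N).const_mul (-φ (τ N))), fun t ht => ?_, fun t ht => ?_⟩
    · rw [indicator_of_mem (mem_Iic.2 ht)]
      rcases le_or_gt t (τ N) with h | h
      · rw [indicator_of_mem (mem_Iic.2 h)]
        simpa using h2 t h
      · rw [indicator_of_notMem (by simpa using h), h3 t h]
        simpa using hφ N t ⟨h.le, ht⟩
    · rw [indicator_of_notMem (by simpa using ht),
        indicator_of_notMem (by simpa using hle.trans_lt ht), h3 t (hle.trans_lt ht)]
      simp

/-- If the sums of the weights converge to the increments of `g` and are bounded in total
variation, then the sums weighted with a continuous function converge to its Stieltjes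
integral. -/
theorem of_continuous (hg : Continuous g) (hbv : LocallyBoundedVariationOn g univ)
    (hw : ∀ t ≤ T, Tendsto (fun n => ∑ k ∈ P.index n t, w n k) atTop (𝓝 (g t - g 0)))
    (hw' : ∃ C : ℝ, ∀ᶠ n in atTop, ∑ k ∈ P.index n T, |w n k| ≤ C)
    (hφ : Continuous φ) : WeightedSumLimit P w g T φ := by
  have hint := integrableOn_stieltjesMeasure hφ g T
  refine ⟨hint, ?_⟩
  obtain ⟨C, hC⟩ := hw'
  set m := (stieltjesMeasure g T).restrict (Icc 0 T) with hm
  set v := m.variation.real univ with hv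
  have hv0 : 0 ≤ v := measureReal_nonneg
  rw [Metric.tendsto_nhds]
  intro ε hε
  set η := ε / (|C| + v + 1) with hη_def
  have hη : 0 < η := by positivity
  -- a fixed partition `𝕋_M`, stopped at `T`, on whose intervals `φ` oscillates by at most `η`
  obtain ⟨M, hM⟩ := (P.eventually_dist_le hφ T hη).exists
  obtain ⟨N, -, -, hN⟩ := P.exists_index_eq_range M T
  obtain ⟨ψ, h1, h2, -⟩ := exists_step (P := P) (w := w) (T := T) (φ := φ)
    (τ := fun j => min (P.point M j) T) hg hbv hw
    (fun i j hij => min_le_min_right T ((P.strictMono M).monotone hij))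
    (by simp [P.point_zero]) (fun j => min_le_right _ _) hη.le (fun j t ht => by
      rcases le_or_gt (P.point M j) T with h | h
      · simp only [min_eq_left h] at ht ⊢
        rw [← Real.dist_eq]
        exact hM j (P.mem_index.2 h) t ⟨ht.1, ht.2.trans (min_le_left _ _)⟩
      · have h' := h.le.trans (P.point_le_succ M j)
        simp only [min_eq_right h.le, min_eq_right h'] at ht ⊢
        rw [le_antisymm ht.2 ht.1]
        simpa using hη.le) (N + 1)
  replace h2 : ∀ t ≤ T, |φ t - ψ t| ≤ η := fun t ht => h2 t (by simpa using ⟨ht.trans hN.le, ht⟩)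
  have hI : |stieltjesIntegral φ g T - stieltjesIntegral ψ g T| ≤ η * v := by
    rw [stieltjesIntegral, stieltjesIntegral, ← VectorMeasure.integral_fun_sub hint h1.1,
      ← Real.norm_eq_abs]
    refine (VectorMeasure.norm_integral_le_of_norm_le_const (C := η) ?_).trans ?_
    · rw [VectorMeasure.variation_restrict measurableSet_Icc]
      filter_upwards [ae_restrict_mem measurableSet_Icc] with t ht using h2 t ht.2
    · simp [hv, hm]
  filter_upwards [hC, (Metric.tendsto_nhds.1 h1.2) η hη] with n hn1 hn2
  have hS : |∑ k ∈ P.index n T, φ (P.point n k) * w n k -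
      ∑ k ∈ P.index n T, ψ (P.point n k) * w n k| ≤ η * |C| := by
    rw [← Finset.sum_sub_distrib]
    calc _ ≤ ∑ k ∈ P.index n T, |φ (P.point n k) * w n k - ψ (P.point n k) * w n k| :=
          Finset.abs_sum_le_sum_abs _ _
      _ ≤ ∑ k ∈ P.index n T, η * |w n k| := by
          refine Finset.sum_le_sum fun k hk => ?_
          rw [← sub_mul, abs_mul]
          exact mul_le_mul_of_nonneg_right (h2 _ (P.mem_index.1 hk)) (abs_nonneg _)
      _ = η * ∑ k ∈ P.index n T, |w n k| := by rw [Finset.mul_sum]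
      _ ≤ η * |C| := by
          gcongr
          exact hn1.trans (le_abs_self C)
  rw [Real.dist_eq] at hn2 ⊢
  have hsum : η * |C| + η + η * v = ε := by
    rw [hη_def]; field_simp; ring
  rw [abs_le] at hS hI
  rw [abs_lt] at hn2 ⊢
  constructor <;> linarith [hS.1, hS.2, hI.1, hI.2, hn2.1, hn2.2]

end WeightedSumLimit

end Stieltjes

/-! ### Pathwise covariations -/

namespace RefiningPartitions

variable {P : RefiningPartitions}

/-- Domination of the weights passes to the increments of the limits of their sums. -/
theorem abs_sub_le_of_tendsto_sum {w b : ℕ → ℕ → ℝ} {g h : ℝ≥0 → ℝ} {s t : ℝ≥0} (hst : s ≤ t)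
    (hw : ∀ u, Tendsto (fun n => ∑ k ∈ P.index n u, w n k) atTop (𝓝 (g u)))
    (hb : ∀ u, Tendsto (fun n => ∑ k ∈ P.index n u, b n k) atTop (𝓝 (h u)))
    (hwb : ∀ᶠ n in atTop, ∀ k ∈ P.index n t, |w n k| ≤ b n k) :
    |g t - g s| ≤ h t - h s := by
  refine le_of_tendsto_of_tendsto ((hw t).sub (hw s)).abs ((hb t).sub (hb s)) ?_
  filter_upwards [hwb] with n hn
  rw [← Finset.sum_sdiff_eq_sub (P.index_subset n hst),
    ← Finset.sum_sdiff_eq_sub (P.index_subset n hst)]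
  exact (Finset.abs_sum_le_sum_abs _ _).trans
    (Finset.sum_le_sum fun k hk => hn k (Finset.sdiff_subset hk))

namespace QV

variable {d : ℕ} {X : ℝ≥0 → Fin d → ℝ}

theorem continuous_apply (hX : P.QV X) (i : Fin d) : Continuous fun t => X t i :=
  (_root_.continuous_apply i).comp hX.continuous

theorem tendsto_covSum (hX : P.QV X) (i j : Fin d) (t : ℝ≥0) :
    Tendsto (fun n => P.covSum (fun s => X s i) (fun s => X s j) n t) atTop
      (𝓝 (P.covariation (fun s => X s i) (fun s => X s j) t)) :=
  tendsto_nhds_limUnder (hX.exists_limit i j t)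

/-- The sum at time `0` consists of the single term for the first partition interval, which vanishes
in the limit. -/
theorem covariation_zero (hX : P.QV X) (i j : Fin d) :
    P.covariation (fun s => X s i) (fun s => X s j) 0 = 0 := by
  have hinc : ∀ i, Tendsto (fun n => X (P.point n 1) i - X (P.point n 0) i) atTop (𝓝 0) := by
    intro i
    have := P.tendsto_sum_increment (hX.continuous_apply i) 0
    simpa [index_zero] using this
  refine tendsto_nhds_unique (hX.tendsto_covSum i j 0) ?_
  simpa [covSum, index_zero] using (hinc i).mul (hinc j)

/-- The covariations are of locally bounded variation, being dominated by the nondecreasing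
functions `[Xᵢ, Xᵢ] + [Xⱼ, Xⱼ]`. -/
theorem abs_covariation_sub_le (hX : P.QV X) (i j : Fin d) {s t : ℝ≥0} (hst : s ≤ t) :
    |P.covariation (fun s => X s i) (fun s => X s j) t -
        P.covariation (fun s => X s i) (fun s => X s j) s| ≤
      (P.covariation (fun s => X s i) (fun s => X s i) t +
        P.covariation (fun s => X s j) (fun s => X s j) t) -
      (P.covariation (fun s => X s i) (fun s => X s i) s +
        P.covariation (fun s => X s j) (fun s => X s j) s) := by
  refine abs_sub_le_of_tendsto_sum
    (b := fun n k => (X (P.point n (k + 1)) i - X (P.point n k) i) *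
      (X (P.point n (k + 1)) i - X (P.point n k) i) + (X (P.point n (k + 1)) j - X (P.point n k) j) *
      (X (P.point n (k + 1)) j - X (P.point n k) j))
    (g := P.covariation (fun s => X s i) (fun s => X s j))
    (h := fun t => P.covariation (fun s => X s i) (fun s => X s i) t +
        P.covariation (fun s => X s j) (fun s => X s j) t) hst (fun u => hX.tendsto_covSum i j u)
    (fun u => ?_) (Eventually.of_forall fun n k _ => ?_)
  · refine ((hX.tendsto_covSum i i u).add (hX.tendsto_covSum j j u)).congr fun n => ?_
    simp only [covSum, Finset.sum_add_distrib]
  · rw [abs_le]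
    constructor <;> nlinarith [mul_self_nonneg (X (P.point n (k + 1)) i - X (P.point n k) i +
      (X (P.point n (k + 1)) j - X (P.point n k) j)),
      mul_self_nonneg (X (P.point n (k + 1)) i - X (P.point n k) i -
      (X (P.point n (k + 1)) j - X (P.point n k) j)),
      mul_self_nonneg (X (P.point n (k + 1)) i - X (P.point n k) i),
      mul_self_nonneg (X (P.point n (k + 1)) j - X (P.point n k) j)]

theorem monotone_covariation_self (hX : P.QV X) (i : Fin d) :
    Monotone (P.covariation (fun s => X s i) (fun s => X s i)) := by
  intro s t hst
  have := (abs_nonneg _).trans (hX.abs_covariation_sub_le i i hst)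
  linarith

theorem locallyBoundedVariationOn_covariation (hX : P.QV X) (i j : Fin d) :
    LocallyBoundedVariationOn (P.covariation (fun s => X s i) (fun s => X s j)) univ :=
  locallyBoundedVariationOn_of_abs_sub_le
    ((hX.monotone_covariation_self i).add (hX.monotone_covariation_self j))
    fun _ _ hst => hX.abs_covariation_sub_le i j hst

theorem tendsto_sum_sq (hX : P.QV X) (T : ℝ≥0) :
    Tendsto (fun n => ∑ k ∈ P.index n T, ∑ i, (X (P.point n (k + 1)) i - X (P.point n k) i) ^ 2)
      atTop (𝓝 (∑ i, P.covariation (fun s => X s i) (fun s => X s i) T)) := by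
  refine (tendsto_finsetSum Finset.univ fun i _ => hX.tendsto_covSum i i T).congr fun n => ?_
  simp only [covSum, sq]
  exact Finset.sum_comm

theorem eventually_sum_sq_le (hX : P.QV X) (T : ℝ≥0) :
    ∃ C : ℝ, ∀ᶠ n in atTop, ∑ k ∈ P.index n T,
      ∑ i, (X (P.point n (k + 1)) i - X (P.point n k) i) ^ 2 ≤ C :=
  ⟨_, (hX.tendsto_sum_sq T).eventually_le_const (lt_add_one _)⟩

theorem tendsto_sum_mul_stieltjesIntegral (hX : P.QV X) (i j : Fin d) {φ : ℝ≥0 → ℝ}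
    (hφ : Continuous φ) (T : ℝ≥0) :
    Tendsto (fun n => ∑ k ∈ P.index n T, φ (P.point n k) *
      ((X (P.point n (k + 1)) i - X (P.point n k) i) *
        (X (P.point n (k + 1)) j - X (P.point n k) j))) atTop
      (𝓝 (stieltjesIntegral φ (P.covariation (fun s => X s i) (fun s => X s j)) T)) := by
  refine (WeightedSumLimit.of_continuous (hX.continuous_covariation i j)
    (hX.locallyBoundedVariationOn_covariation i j) (fun t _ => ?_) ?_ hφ).2
  · rw [hX.covariation_zero, sub_zero]
    exact hX.tendsto_covSum i j t
  · obtain ⟨C, hC⟩ := hX.eventually_sum_sq_le T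
    refine ⟨C, hC.mono fun n hn => le_trans (Finset.sum_le_sum fun k _ => ?_) hn⟩
    have h : ∀ l, (X (P.point n (k + 1)) l - X (P.point n k) l) ^ 2 ≤
        ∑ i, (X (P.point n (k + 1)) i - X (P.point n k) i) ^ 2 := fun l =>
      Finset.single_le_sum (f := fun i => (X (P.point n (k + 1)) i - X (P.point n k) i) ^ 2)
        (fun i _ => sq_nonneg _) (Finset.mem_univ l)
    have h1 := h i
    have h2 := h j
    rw [abs_mul]
    nlinarith [sq_nonneg (|X (P.point n (k + 1)) i - X (P.point n k) i| -
      |X (P.point n (k + 1)) j - X (P.point n k) j|),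
      sq_abs (X (P.point n (k + 1)) i - X (P.point n k) i),
      sq_abs (X (P.point n (k + 1)) j - X (P.point n k) j)]

theorem tendsto_sum_quadratic (hX : P.QV X) {φ : Fin d → Fin d → ℝ≥0 → ℝ}
    (hφ : ∀ i j, Continuous (φ i j)) (T : ℝ≥0) :
    Tendsto (fun n => ∑ k ∈ P.index n T, ∑ i, ∑ j, φ i j (P.point n k) *
      ((X (P.point n (k + 1)) i - X (P.point n k) i) *
        (X (P.point n (k + 1)) j - X (P.point n k) j))) atTop
      (𝓝 (∑ i, ∑ j, stieltjesIntegral (φ i j)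
        (P.covariation (fun s => X s i) (fun s => X s j)) T)) := by
  refine (tendsto_finsetSum Finset.univ fun i _ => tendsto_finsetSum Finset.univ fun j _ =>
    hX.tendsto_sum_mul_stieltjesIntegral i j (hφ i j) T).congr fun n => ?_
  simp only [Finset.sum_comm (s := P.index n T)]

theorem stieltjesIntegrable (hX : P.QV X) (i j : Fin d) {φ : ℝ≥0 → ℝ} (hφ : Continuous φ) :
    StieltjesIntegrable φ (P.covariation (fun s => X s i) (fun s => X s j)) :=
  .of_continuous hφ (hX.continuous_covariation i j) (hX.locallyBoundedVariationOn_covariation i j)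

end QV

theorem tendsto_sum_mul_increment (P : RefiningPartitions) {A φ : ℝ≥0 → ℝ} (hA : Continuous A)
    (hbv : LocallyBoundedVariationOn A univ) (hφ : Continuous φ) (T : ℝ≥0) :
    Tendsto (fun n => ∑ k ∈ P.index n T, φ (P.point n k) *
      (A (P.point n (k + 1)) - A (P.point n k))) atTop (𝓝 (stieltjesIntegral φ A T)) :=
  (WeightedSumLimit.of_continuous hA hbv (fun t _ => P.tendsto_sum_increment hA t)
    (P.eventually_sum_abs_increment_le hbv T) hφ).2

end RefiningPartitions

/-! ### Functions of class `C^{2,1}` -/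

theorem clm_apply_eq_sum {d : ℕ} (L : (Fin d → ℝ) →L[ℝ] ℝ) (v : Fin d → ℝ) :
    L v = ∑ i, v i * L (Pi.single i 1) := by
  conv_lhs => rw [pi_eq_sum_univ' v]
  simp [map_sum, Pi.single]

theorem continuousOn_clm_of_single {d : ℕ} {E : Type*} [TopologicalSpace E] {s : Set E}
    {L : E → (Fin d → ℝ) →L[ℝ] ℝ} (h : ∀ i, ContinuousOn (fun p => L p (Pi.single i 1)) s) :
    ContinuousOn L s := by
  refine continuousOn_clm_apply.2 fun v => ?_
  simp only [clm_apply_eq_sum _ v]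
  exact continuousOn_finsetSum _ fun i _ => continuousOn_const.mul (h i)

namespace IsC21

variable {d m : ℕ} {U : Set (Fin d → ℝ)} {V : Set (Fin m → ℝ)}
  {G : (Fin d → ℝ) → (Fin m → ℝ) → ℝ}

theorem hasFDerivAt_left (hG : IsC21 U V G) (hU : IsOpen U) {x : Fin d → ℝ} (hx : x ∈ U)
    {a : Fin m → ℝ} (ha : a ∈ V) :
    HasFDerivAt (fun y => G y a) (fderiv ℝ (fun y => G y a) x) x :=
  (((hG.contDiffOn_two a ha).differentiableOn (by norm_num)).differentiableAt
    (hU.mem_nhds hx)).hasFDerivAt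

theorem hasFDerivAt_partialX (hG : IsC21 U V G) (hU : IsOpen U) (i : Fin d) {x : Fin d → ℝ}
    (hx : x ∈ U) {a : Fin m → ℝ} (ha : a ∈ V) :
    HasFDerivAt (fun y => partialX i G y a) (fderiv ℝ (fun y => partialX i G y a) x) x := by
  have h1 : ContDiffOn ℝ 1 (fderiv ℝ fun y => G y a) U :=
    (hG.contDiffOn_two a ha).fderiv_of_isOpen hU (by norm_num)
  have h2 : DifferentiableAt ℝ (fderiv ℝ fun y => G y a) x :=
    (h1.differentiableOn (by norm_num)).differentiableAt (hU.mem_nhds hx)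
  exact (h2.clm_apply (differentiableAt_const _)).hasFDerivAt

theorem hasFDerivAt_uncurry (hG : IsC21 U V G) (hU : IsOpen U) (hV : IsOpen V) {x : Fin d → ℝ}
    (hx : x ∈ U) {a : Fin m → ℝ} (ha : a ∈ V) :
    HasFDerivAt (fun p : (Fin d → ℝ) × (Fin m → ℝ) => G p.1 p.2)
      (fderiv ℝ (fun p : (Fin d → ℝ) × (Fin m → ℝ) => G p.1 p.2) (x, a)) (x, a) :=
  ((hG.contDiffOn_one.differentiableOn (by norm_num)).differentiableAt
    ((hU.prod hV).mem_nhds ⟨hx, ha⟩)).hasFDerivAt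

theorem hasFDerivAt_right (hG : IsC21 U V G) (hU : IsOpen U) (hV : IsOpen V) {x : Fin d → ℝ}
    (hx : x ∈ U) {a : Fin m → ℝ} (ha : a ∈ V) :
    HasFDerivAt (fun b => G x b) (fderiv ℝ (fun b => G x b) a) a :=
  ((hG.hasFDerivAt_uncurry hU hV hx ha).comp a
    (hasFDerivAt_prodMk_right x a)).differentiableAt.hasFDerivAt

theorem continuousOn (hG : IsC21 U V G) :
    ContinuousOn (fun p : (Fin d → ℝ) × (Fin m → ℝ) => G p.1 p.2) (U ×ˢ V) :=
  hG.contDiffOn_one.continuousOn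

theorem continuousOn_partialX (hG : IsC21 U V G) (hU : IsOpen U) (hV : IsOpen V) (i : Fin d) :
    ContinuousOn (fun p : (Fin d → ℝ) × (Fin m → ℝ) => partialX i G p.1 p.2) (U ×ˢ V) := by
  have h := (hG.contDiffOn_one.continuousOn_fderiv_of_isOpen (hU.prod hV) le_rfl).clm_apply
    (continuousOn_const (c := ((Pi.single i 1, 0) : (Fin d → ℝ) × (Fin m → ℝ))))
  refine h.congr fun p hp => ?_
  have := ((hG.hasFDerivAt_uncurry hU hV hp.1 hp.2).comp p.1
    (f := fun x => (x, p.2)) (hasFDerivAt_prodMk_left p.1 p.2)).fderiv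
  simp only [partialX, Function.comp_def] at this ⊢
  rw [this]
  simp

theorem continuousOn_partialA (hG : IsC21 U V G) (hU : IsOpen U) (hV : IsOpen V) (k : Fin m) :
    ContinuousOn (fun p : (Fin d → ℝ) × (Fin m → ℝ) => partialA k G p.1 p.2) (U ×ˢ V) := by
  have h := (hG.contDiffOn_one.continuousOn_fderiv_of_isOpen (hU.prod hV) le_rfl).clm_apply
    (continuousOn_const (c := ((0, Pi.single k 1) : (Fin d → ℝ) × (Fin m → ℝ))))
  refine h.congr fun p hp => ?_
  have := ((hG.hasFDerivAt_uncurry hU hV hp.1 hp.2).comp p.2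
    (f := fun a => (p.1, a)) (hasFDerivAt_prodMk_right p.1 p.2)).fderiv
  simp only [partialA, Function.comp_def] at this ⊢
  rw [this]
  simp

end IsC21

/-- A one-dimensional Taylor estimate in terms of the oscillation of the second derivative. -/
theorem abs_taylor_two_le {q q' q'' : ℝ → ℝ} {C : ℝ}
    (hq : ∀ t ∈ Icc (0 : ℝ) 1, HasDerivAt q (q' t) t)
    (hq' : ∀ t ∈ Icc (0 : ℝ) 1, HasDerivAt q' (q'' t) t)
    (hC : ∀ t ∈ Icc (0 : ℝ) 1, |q'' t - q'' 0| ≤ C) :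
    |q 1 - q 0 - q' 0 - 1 / 2 * q'' 0| ≤ C := by
  have hC0 : 0 ≤ C := (abs_nonneg _).trans (hC 0 (by simp))
  have h1 : ∀ t ∈ Icc (0 : ℝ) 1, |q' t - q' 0 - q'' 0 * t| ≤ C := by
    intro t ht
    have := norm_image_sub_le_of_norm_deriv_le_segment' (f := fun t => q' t - q'' 0 * t)
      (f' := fun t => q'' t - q'' 0) (C := C) (a := 0) (b := 1)
      (fun s hs => (((hq' s hs).sub ((hasDerivAt_id s).const_mul (q'' 0))).congr_deriv
        (by simp)).hasDerivWithinAt)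
      (fun s hs => by simpa using hC s ⟨hs.1, hs.2.le⟩) t ht
    have h2 : |q' t - q'' 0 * t - (q' 0 - q'' 0 * 0)| ≤ C * (t - 0) := this
    have h3 : C * (t - 0) ≤ C := by nlinarith [ht.2]
    calc |q' t - q' 0 - q'' 0 * t| = |q' t - q'' 0 * t - (q' 0 - q'' 0 * 0)| := by ring_nf
      _ ≤ C := h2.trans h3
  have h2 := norm_image_sub_le_of_norm_deriv_le_segment_01'
    (f := fun t => q t - q' 0 * t - q'' 0 * (t ^ 2 / 2))
    (f' := fun t => q' t - q' 0 - q'' 0 * t) (C := C)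
    (fun t ht => by
      have := ((hq t ht).sub ((hasDerivAt_id t).const_mul (q' 0))).sub
        ((((hasDerivAt_id t).pow 2).div_const 2).const_mul (q'' 0))
      refine (this.congr_deriv ?_).hasDerivWithinAt
      simp)
    (fun t ht => h1 t ⟨ht.1, ht.2.le⟩)
  rw [Real.norm_eq_abs] at h2
  calc _ = |q 1 - q' 0 * 1 - q'' 0 * (1 ^ 2 / 2) - (q 0 - q' 0 * 0 - q'' 0 * (0 ^ 2 / 2))| := by
        ring_nf
    _ ≤ C := h2

theorem abs_sum_sum_mul_le {d : ℕ} {c : Fin d → Fin d → ℝ} {ε : ℝ} (hc : ∀ i j, |c i j| ≤ ε)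
    (v : Fin d → ℝ) : |∑ i, ∑ j, c i j * (v i * v j)| ≤ ε * d * ∑ i, v i ^ 2 := by
  calc |∑ i, ∑ j, c i j * (v i * v j)| ≤ ∑ i, ∑ j, |c i j * (v i * v j)| :=
        (Finset.abs_sum_le_sum_abs _ _).trans
          (Finset.sum_le_sum fun i _ => Finset.abs_sum_le_sum_abs _ _)
    _ ≤ ∑ i, ∑ j, ε * ((v i ^ 2 + v j ^ 2) / 2) := by
        refine Finset.sum_le_sum fun i _ => Finset.sum_le_sum fun j _ => ?_
        have hε : 0 ≤ ε := (abs_nonneg _).trans (hc i j)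
        rw [abs_mul, abs_mul]
        refine mul_le_mul (hc i j) ?_ (by positivity) hε
        nlinarith [sq_nonneg (|v i| - |v j|), sq_abs (v i), sq_abs (v j)]
    _ = ε * d * ∑ i, v i ^ 2 := by
        simp only [← Finset.mul_sum, ← Finset.sum_div, Finset.sum_add_distrib, Finset.sum_const,
          Finset.card_univ, Fintype.card_fin, nsmul_eq_mul]
        ring

/-- The oscillation near a compact set of a function that is continuous on an open set containing
it. -/
theorem exists_dist_lt_of_continuousOn {E F : Type*} [PseudoMetricSpace E] [PseudoMetricSpace F]
    {O K : Set E} (hO : IsOpen O) (hK : IsCompact K) (hKO : K ⊆ O) {H : E → F}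
    (hH : ContinuousOn H O) {ε : ℝ} (hε : 0 < ε) :
    ∃ δ > 0, ∀ p ∈ K, ∀ q, dist q p < δ → q ∈ O ∧ dist (H q) (H p) < ε := by
  obtain ⟨δ₁, hδ₁, h₁⟩ := hK.exists_thickening_subset_open hO hKO
  have h₂ := hK.uniformContinuousAt_of_continuousAt H
    (fun p hp => hH.continuousAt (hO.mem_nhds (hKO hp))) (Metric.dist_mem_uniformity hε)
  obtain ⟨δ₂, hδ₂, h₂⟩ := Metric.mem_uniformity_dist.1 h₂
  refine ⟨min δ₁ δ₂, lt_min hδ₁ hδ₂, fun p hp q hq => ⟨?_, ?_⟩⟩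
  · exact h₁ (Metric.mem_thickening_iff.2 ⟨p, hp, hq.trans_le (min_le_left _ _)⟩)
  · have := h₂ (a := p) (b := q) (by rw [dist_comm]; exact hq.trans_le (min_le_right _ _)) hp
    rw [dist_comm]
    exact this

namespace IsC21

variable {d m : ℕ} {U : Set (Fin d → ℝ)} {V : Set (Fin m → ℝ)}
  {G : (Fin d → ℝ) → (Fin m → ℝ) → ℝ}

/-- The remainder of the expansion of `G` to the second order in `x` and the first order in
`a`. -/
noncomputable def remainder (G : (Fin d → ℝ) → (Fin m → ℝ) → ℝ) (x : Fin d → ℝ) (a : Fin m → ℝ)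
    (x' : Fin d → ℝ) (a' : Fin m → ℝ) : ℝ :=
  G x' a' - G x a - ∑ i, partialX i G x a * (x' i - x i)
    - 1 / 2 * ∑ i, ∑ j, partialX j (partialX i G) x a * ((x' i - x i) * (x' j - x j))
    - ∑ l, partialA l G x a * (a' l - a l)

theorem exists_abs_remainder_le (hG : IsC21 U V G) (hU : IsOpen U) (hV : IsOpen V)
    {K : Set ((Fin d → ℝ) × (Fin m → ℝ))} (hK : IsCompact K) (hKUV : K ⊆ U ×ˢ V) {ε : ℝ}
    (hε : 0 < ε) :
    ∃ δ > 0, ∀ x a, (x, a) ∈ K → ∀ x' a', dist (x', a') (x, a) < δ →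
      |remainder G x a x' a'| ≤ ε * (∑ i, (x' i - x i) ^ 2 + ∑ l, |a' l - a l|) := by
  -- `(∑ |Δxᵢ|)² ≤ d ∑ |Δxᵢ|²` costs a factor `d`, and `d + 1` avoids a zero denominator
  set η := ε / (d + 1) with hη_def
  have hη : 0 < η := by positivity
  have hηd : η * d ≤ ε := by
    rw [hη_def, div_mul_eq_mul_div, div_le_iff₀ (by positivity)]
    nlinarith
  have hηε : η ≤ ε := div_le_self hε.le (by linarith [(Nat.cast_nonneg d : (0 : ℝ) ≤ d)])
  have hcont : ContinuousOn (fun p : (Fin d → ℝ) × (Fin m → ℝ) =>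
      ((fun i j => partialX j (partialX i G) p.1 p.2 : Fin d → Fin d → ℝ),
        (fun l => partialA l G p.1 p.2 : Fin m → ℝ))) (U ×ˢ V) :=
    (continuousOn_pi.2 fun i => continuousOn_pi.2 fun j => hG.continuousOn_second i j).prodMk
      (continuousOn_pi.2 fun l => hG.continuousOn_partialA hU hV l)
  obtain ⟨δ, hδ, h⟩ := exists_dist_lt_of_continuousOn (hU.prod hV) hK hKUV hcont hη
  refine ⟨δ, hδ, fun x a hp x' a' hd => ?_⟩
  have hx : x ∈ U := (hKUV hp).1
  have ha : a ∈ V := (hKUV hp).2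
  have hdx : dist x' x < δ := (le_max_left _ _).trans_lt hd
  have hda : dist a' a < δ := (le_max_right _ _).trans_lt hd
  have hH : ∀ q, dist q (x, a) < δ → ∀ i j,
      |partialX j (partialX i G) q.1 q.2 - partialX j (partialX i G) x a| ≤ η := by
    intro q hq i j
    rw [← Real.dist_eq]
    exact (((dist_le_pi_dist (fun j => partialX j (partialX i G) q.1 q.2)
      (fun j => partialX j (partialX i G) x a) j).trans
      (dist_le_pi_dist (fun i j => partialX j (partialX i G) q.1 q.2)
      (fun i j => partialX j (partialX i G) x a) i)).trans
      (le_max_left _ _)).trans (h _ hp q hq).2.le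
  have hD : ∀ q, dist q (x, a) < δ → ∀ l, |partialA l G q.1 q.2 - partialA l G x a| ≤ η := by
    intro q hq l
    rw [← Real.dist_eq]
    exact ((dist_le_pi_dist _ _ l).trans (le_max_right _ _)).trans (h _ hp q hq).2.le
  -- in `a`: the mean value inequality at the fixed point `x'`, with derivatives compared at `(x, a)`
  have hA : |G x' a' - G x' a - ∑ l, partialA l G x a * (a' l - a l)| ≤
      η * ∑ l, |a' l - a l| := by
    have hseg : ∀ s ∈ Icc (0 : ℝ) 1, dist (x', a + s • (a' - a)) (x, a) < δ := by
      intro s hs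
      refine max_lt hdx (lt_of_le_of_lt ?_ hda)
      rw [dist_eq_norm, dist_eq_norm, add_sub_cancel_left, norm_smul, Real.norm_eq_abs,
        abs_of_nonneg hs.1]
      exact mul_le_of_le_one_left (norm_nonneg _) hs.2
    have key := norm_image_sub_le_of_norm_deriv_le_segment_01'
      (f := fun s : ℝ => G x' (a + s • (a' - a)) - s * ∑ l, partialA l G x a * (a' l - a l))
      (f' := fun s => ∑ l, (partialA l G x' (a + s • (a' - a)) - partialA l G x a) * (a' l - a l))
      (C := η * ∑ l, |a' l - a l|)
      (fun s hs => by
        have hmem := (h _ hp _ (hseg s hs)).1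
        have h1 := (hG.hasFDerivAt_right hU hV hmem.1 hmem.2).comp_hasDerivAt s
          (((hasDerivAt_id s).smul_const (a' - a)).const_add a)
        refine ((h1.sub ((hasDerivAt_id s).mul_const
          (∑ l, partialA l G x a * (a' l - a l)))).congr_deriv ?_).hasDerivWithinAt
        rw [clm_apply_eq_sum, one_mul, ← Finset.sum_sub_distrib]
        refine Finset.sum_congr rfl fun l _ => ?_
        simp only [partialA, one_smul, Pi.sub_apply]
        ring)
      (fun s hs => by
        rw [Real.norm_eq_abs, Finset.mul_sum]
        refine (Finset.abs_sum_le_sum_abs _ _).trans (Finset.sum_le_sum fun l _ => ?_)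
        rw [abs_mul]
        exact mul_le_mul_of_nonneg_right (hD _ (hseg s ⟨hs.1, hs.2.le⟩) l) (abs_nonneg _))
    rw [Real.norm_eq_abs] at key
    simp only [one_smul, zero_smul, add_zero, add_sub_cancel, one_mul, zero_mul, sub_zero] at key
    calc _ = _ := by congr 1; ring
      _ ≤ _ := key
  -- in `x`: a second-order expansion along the segment from `x` to `x'`, at the fixed point `a`
  have hX : |G x' a - G x a - ∑ i, partialX i G x a * (x' i - x i)
      - 1 / 2 * ∑ i, ∑ j, partialX j (partialX i G) x a * ((x' i - x i) * (x' j - x j))| ≤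
      η * d * ∑ i, (x' i - x i) ^ 2 := by
    have hseg : ∀ s ∈ Icc (0 : ℝ) 1, dist (x + s • (x' - x), a) (x, a) < δ := by
      intro s hs
      refine max_lt (lt_of_le_of_lt ?_ hdx) (by simpa using hδ)
      rw [dist_eq_norm, dist_eq_norm, add_sub_cancel_left, norm_smul, Real.norm_eq_abs,
        abs_of_nonneg hs.1]
      exact mul_le_of_le_one_left (norm_nonneg _) hs.2
    have key := abs_taylor_two_le (q := fun s => G (x + s • (x' - x)) a)
      (q' := fun s => ∑ i, partialX i G (x + s • (x' - x)) a * (x' i - x i))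
      (q'' := fun s => ∑ i, ∑ j, partialX j (partialX i G) (x + s • (x' - x)) a *
        ((x' i - x i) * (x' j - x j)))
      (C := η * d * ∑ i, (x' i - x i) ^ 2)
      (fun s hs => by
        have hmem := (h _ hp _ (hseg s hs)).1
        have h1 := (hG.hasFDerivAt_left hU hmem.1 hmem.2).comp_hasDerivAt s
          (((hasDerivAt_id s).smul_const (x' - x)).const_add x)
        refine h1.congr_deriv ?_
        rw [clm_apply_eq_sum]
        refine Finset.sum_congr rfl fun i _ => ?_
        simp only [partialX, one_smul, Pi.sub_apply]
        ring)
      (fun s hs => by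
        have hmem := (h _ hp _ (hseg s hs)).1
        refine (HasDerivAt.fun_sum fun i _ => ((hG.hasFDerivAt_partialX hU i
          hmem.1 hmem.2).comp_hasDerivAt s (((hasDerivAt_id s).smul_const
          (x' - x)).const_add x)).mul_const (x' i - x i)).congr_deriv ?_
        refine Finset.sum_congr rfl fun i _ => ?_
        rw [clm_apply_eq_sum, Finset.sum_mul]
        refine Finset.sum_congr rfl fun j _ => ?_
        simp only [partialX, one_smul, Pi.sub_apply]
        ring)
      (fun s hs => by
        simp only [← Finset.sum_sub_distrib, ← sub_mul, zero_smul, add_zero]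
        exact abs_sum_sum_mul_le (hH _ (hseg s hs)) (x' - x))
    simpa using key
  have hsq : 0 ≤ ∑ i, (x' i - x i) ^ 2 := Finset.sum_nonneg fun _ _ => sq_nonneg _
  have habs : 0 ≤ ∑ l, |a' l - a l| := Finset.sum_nonneg fun _ _ => abs_nonneg _
  have hsplit : remainder G x a x' a' =
      (G x' a' - G x' a - ∑ l, partialA l G x a * (a' l - a l)) +
      (G x' a - G x a - ∑ i, partialX i G x a * (x' i - x i)
      - 1 / 2 * ∑ i, ∑ j, partialX j (partialX i G) x a * ((x' i - x i) * (x' j - x j))) := by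
    rw [remainder]; ring
  rw [hsplit]
  refine (abs_add_le _ _).trans ((add_le_add hA hX).trans ?_)
  nlinarith [mul_le_mul_of_nonneg_right hηd hsq, mul_le_mul_of_nonneg_right hηε habs]

/-- Along continuous paths the remainder is small relative to `|Δx|² + |Δa|`, uniformly over the
partition intervals starting before `T`. -/
theorem eventually_abs_remainder_le (hG : IsC21 U V G) (hU : IsOpen U) (hV : IsOpen V)
    (P : RefiningPartitions) {X : ℝ≥0 → Fin d → ℝ} {A : ℝ≥0 → Fin m → ℝ} (hX : Continuous X)
    (hA : Continuous A) (hXU : ∀ t, X t ∈ U) (hAV : ∀ t, A t ∈ V) (T : ℝ≥0) {ε : ℝ} (hε : 0 < ε) :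
    ∀ᶠ n in atTop, ∀ k ∈ P.index n T,
      |remainder G (X (P.point n k)) (A (P.point n k)) (X (P.point n (k + 1)))
        (A (P.point n (k + 1)))| ≤
      ε * (∑ i, (X (P.point n (k + 1)) i - X (P.point n k) i) ^ 2 +
        ∑ l, |A (P.point n (k + 1)) l - A (P.point n k) l|) := by
  have hXA : Continuous fun t => (X t, A t) := hX.prodMk hA
  obtain ⟨δ, hδ, h⟩ := hG.exists_abs_remainder_le hU hV
    ((isCompact_Icc (a := (0 : ℝ≥0)) (b := T)).image hXA)
    (by rintro _ ⟨t, -, rfl⟩; exact ⟨hXU t, hAV t⟩) hε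
  filter_upwards [P.eventually_dist_le hXA T (half_pos hδ)] with n hn k hk
  exact h _ _ ⟨P.point n k, ⟨zero_le, P.mem_index.1 hk⟩, rfl⟩ _ _
    ((hn k hk _ (right_mem_Icc.2 (P.point_le_succ n k))).trans_lt (half_lt_self hδ))

end IsC21

/-! ### Generated portfolios are admissible integrands -/

section PartialC1

variable {d m : ℕ} {U : Set (Fin d → ℝ)} {V : Set (Fin m → ℝ)}

/-- `h(x, a)` is continuous on `U × V`, and differentiable in `x` with a derivative that is
continuous on `U × V`. -/
def IsPartialC1 (U : Set (Fin d → ℝ)) (V : Set (Fin m → ℝ))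
    (h : (Fin d → ℝ) → (Fin m → ℝ) → ℝ) : Prop :=
  ContinuousOn (fun p : (Fin d → ℝ) × (Fin m → ℝ) => h p.1 p.2) (U ×ˢ V) ∧
  ∃ h' : (Fin d → ℝ) → (Fin m → ℝ) → (Fin d → ℝ) →L[ℝ] ℝ,
    (∀ x ∈ U, ∀ a ∈ V, HasFDerivAt (fun y => h y a) (h' x a) x) ∧
    ContinuousOn (fun p : (Fin d → ℝ) × (Fin m → ℝ) => h' p.1 p.2) (U ×ˢ V)

namespace IsPartialC1

variable {g h : (Fin d → ℝ) → (Fin m → ℝ) → ℝ}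

theorem add (hg : IsPartialC1 U V g) (hh : IsPartialC1 U V h) :
    IsPartialC1 U V fun x a => g x a + h x a := by
  obtain ⟨hg, g', hg', hgc⟩ := hg
  obtain ⟨hh, h', hh', hhc⟩ := hh
  exact ⟨hg.add hh, fun x a => g' x a + h' x a,
    fun x hx a ha => (hg' x hx a ha).add (hh' x hx a ha), hgc.add hhc⟩

theorem mul (hg : IsPartialC1 U V g) (hh : IsPartialC1 U V h) :
    IsPartialC1 U V fun x a => g x a * h x a := by
  obtain ⟨hg, g', hg', hgc⟩ := hg
  obtain ⟨hh, h', hh', hhc⟩ := hh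
  exact ⟨hg.mul hh, fun x a => g x a • h' x a + h x a • g' x a,
    fun x hx a ha => (hg' x hx a ha).mul (hh' x hx a ha),
    (hg.smul hhc).add (hh.smul hgc)⟩

theorem const (c : ℝ) : IsPartialC1 U V fun _ _ => c :=
  ⟨continuousOn_const, fun _ _ => 0, fun x _ _ _ => hasFDerivAt_const c x, continuousOn_const⟩

theorem sub (hg : IsPartialC1 U V g) (hh : IsPartialC1 U V h) :
    IsPartialC1 U V fun x a => g x a - h x a := by
  simpa only [neg_one_mul, ← sub_eq_add_neg] using hg.add ((const (-1)).mul hh)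

theorem sum {ι : Type*} {s : Finset ι} {h : ι → (Fin d → ℝ) → (Fin m → ℝ) → ℝ}
    (hh : ∀ i ∈ s, IsPartialC1 U V (h i)) : IsPartialC1 U V fun x a => ∑ i ∈ s, h i x a := by
  classical
  induction s using Finset.induction_on with
  | empty => simpa using const 0
  | insert i s hi ih =>
    simp only [Finset.sum_insert hi]
    exact (hh i (Finset.mem_insert_self i s)).add
      (ih fun j hj => hh j (Finset.mem_insert_of_mem hj))

theorem inv (hg : IsPartialC1 U V g) (hg0 : ∀ x ∈ U, ∀ a ∈ V, g x a ≠ 0) :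
    IsPartialC1 U V fun x a => (g x a)⁻¹ := by
  obtain ⟨hg, g', hg', hgc⟩ := hg
  have h0 : ∀ p ∈ U ×ˢ V, g p.1 p.2 ≠ 0 := fun p hp => hg0 _ hp.1 _ hp.2
  refine ⟨hg.inv₀ h0, fun x a => (-(g x a ^ 2)⁻¹) • g' x a, fun x hx a ha => ?_,
    ((hg.pow 2).inv₀ fun p hp => pow_ne_zero 2 (h0 p hp)).neg.smul hgc⟩
  exact (hasDerivAt_inv (hg0 x hx a ha)).comp_hasFDerivAt x (hg' x hx a ha)

theorem div (hg : IsPartialC1 U V g) (hh : IsPartialC1 U V h)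
    (hh0 : ∀ x ∈ U, ∀ a ∈ V, h x a ≠ 0) : IsPartialC1 U V fun x a => g x a / h x a := by
  simpa only [div_eq_mul_inv] using hg.mul (hh.inv hh0)

theorem comp {U' : Set (Fin d → ℝ)} (hh : IsPartialC1 U V h) {φ : (Fin d → ℝ) → Fin d → ℝ}
    {φ' : (Fin d → ℝ) → (Fin d → ℝ) →L[ℝ] (Fin d → ℝ)}
    (hφ : ∀ x ∈ U', HasFDerivAt φ (φ' x) x) (hφ' : ContinuousOn φ' U') (hmaps : MapsTo φ U' U) :
    IsPartialC1 U' V fun x a => h (φ x) a := by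
  obtain ⟨hh, h', hh', hhc⟩ := hh
  have hφc : ContinuousOn φ U' := fun x hx => (hφ x hx).continuousAt.continuousWithinAt
  have hc : ContinuousOn (fun p : (Fin d → ℝ) × (Fin m → ℝ) => (φ p.1, p.2)) (U' ×ˢ V) :=
    (hφc.comp continuousOn_fst fun p hp => hp.1).prodMk continuousOn_snd
  have hm : MapsTo (fun p : (Fin d → ℝ) × (Fin m → ℝ) => (φ p.1, p.2)) (U' ×ˢ V) (U ×ˢ V) :=
    fun p hp => ⟨hmaps hp.1, hp.2⟩
  exact ⟨hh.comp hc hm, fun x a => (h' (φ x) a).comp (φ' x),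
    fun x hx a ha => (hh' _ (hmaps hx) a ha).comp x (hφ x hx),
    (hhc.comp hc hm).clm_comp (hφ'.comp continuousOn_fst fun p hp => hp.1)⟩

theorem continuousOn_partialX (hh : IsPartialC1 U V h) (i : Fin d) :
    ContinuousOn (fun p : (Fin d → ℝ) × (Fin m → ℝ) => partialX i h p.1 p.2) (U ×ˢ V) := by
  obtain ⟨-, h', hh', hhc⟩ := hh
  refine (hhc.clm_apply (continuousOn_const (c := Pi.single i (1 : ℝ)))).congr fun p hp => ?_
  rw [partialX, (hh' p.1 hp.1 p.2 hp.2).fderiv]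

end IsPartialC1

namespace IsC21

variable {G : (Fin d → ℝ) → (Fin m → ℝ) → ℝ}

theorem isPartialC1 (hG : IsC21 U V G) (hU : IsOpen U) (hV : IsOpen V) : IsPartialC1 U V G :=
  ⟨hG.continuousOn, fun x a => fderiv ℝ (fun y => G y a) x,
    fun _ hx _ ha => hG.hasFDerivAt_left hU hx ha,
    continuousOn_clm_of_single fun i => hG.continuousOn_partialX hU hV i⟩

theorem isPartialC1_partialX (hG : IsC21 U V G) (hU : IsOpen U) (i : Fin d)
    (hV : IsOpen V) : IsPartialC1 U V (partialX i G) :=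
  ⟨hG.continuousOn_partialX hU hV i, fun x a => fderiv ℝ (fun y => partialX i G y a) x,
    fun _ hx _ ha => hG.hasFDerivAt_partialX hU i hx ha,
    continuousOn_clm_of_single fun j => hG.continuousOn_second i j⟩

theorem partialX_log (hG : IsC21 U V G) (hU : IsOpen U) {x : Fin d → ℝ} (hx : x ∈ U)
    {a : Fin m → ℝ} (ha : a ∈ V) (h0 : G x a ≠ 0) (i : Fin d) :
    partialX i (fun x a => Real.log (G x a)) x a = partialX i G x a / G x a := by
  rw [partialX, ((hG.hasFDerivAt_left hU hx ha).log h0).fderiv]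
  simp [partialX, div_eq_inv_mul]

end IsC21

end PartialC1

section Softmax

variable {d : ℕ}

/-- The function `log (∑ᵢ exp xᵢ)`. -/
noncomputable def logSumExp (x : Fin d → ℝ) : ℝ := Real.log (∑ i, Real.exp (x i))

/-- The gradient of `logSumExp`: the market weights as a function of the log-prices. -/
noncomputable def softmax (x : Fin d → ℝ) : Fin d → ℝ := fun i => Real.exp (x i - logSumExp x)

/-- The derivative of `logSumExp`. -/
noncomputable def logSumExpDeriv (x : Fin d → ℝ) : (Fin d → ℝ) →L[ℝ] ℝ :=
  ∑ i, softmax x i • ContinuousLinearMap.proj i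

/-- The derivative of `softmax`. -/
noncomputable def softmaxDeriv (x : Fin d → ℝ) : (Fin d → ℝ) →L[ℝ] (Fin d → ℝ) :=
  ContinuousLinearMap.pi fun i =>
    softmax x i • (ContinuousLinearMap.proj i - logSumExpDeriv x)

theorem sum_exp_pos (hd : 0 < d) (x : Fin d → ℝ) : 0 < ∑ i, Real.exp (x i) :=
  Finset.sum_pos (fun _ _ => Real.exp_pos _) ⟨⟨0, hd⟩, Finset.mem_univ _⟩

theorem softmax_eq (hd : 0 < d) (x : Fin d → ℝ) (i : Fin d) :
    softmax x i = Real.exp (x i) / ∑ j, Real.exp (x j) := by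
  rw [softmax, logSumExp, Real.exp_sub, Real.exp_log (sum_exp_pos hd x)]

theorem softmax_mem_openSimplex (hd : 0 < d) (x : Fin d → ℝ) : softmax x ∈ openSimplex d := by
  refine ⟨⟨fun i => (Real.exp_pos _).le, ?_⟩, fun i => Real.exp_pos _⟩
  simp only [softmax_eq hd, ← Finset.sum_div]
  exact div_self (sum_exp_pos hd x).ne'

theorem contDiff_logSumExp (hd : 0 < d) {n : WithTop ℕ∞} :
    ContDiff ℝ n (logSumExp : (Fin d → ℝ) → ℝ) :=
  (ContDiff.sum fun i _ => (contDiff_apply ℝ ℝ i).exp).log fun x => (sum_exp_pos hd x).ne'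

theorem contDiff_softmax (hd : 0 < d) {n : WithTop ℕ∞} :
    ContDiff ℝ n (softmax : (Fin d → ℝ) → Fin d → ℝ) :=
  contDiff_pi.2 fun i => ((contDiff_apply ℝ ℝ i).sub (contDiff_logSumExp hd)).exp

theorem hasFDerivAt_logSumExp (hd : 0 < d) (x : Fin d → ℝ) :
    HasFDerivAt logSumExp (logSumExpDeriv x) x := by
  have h := (HasFDerivAt.fun_sum (u := Finset.univ)
    fun i _ => (hasFDerivAt_apply (𝕜 := ℝ) (F' := fun _ : Fin d => ℝ) i x).exp).log
    (sum_exp_pos hd x).ne'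
  refine h.congr_fderiv ?_
  simp only [logSumExpDeriv, softmax_eq hd, Finset.smul_sum, smul_smul, div_eq_inv_mul]

theorem hasFDerivAt_softmax (hd : 0 < d) (x : Fin d → ℝ) :
    HasFDerivAt softmax (softmaxDeriv x) x :=
  hasFDerivAt_pi.2 fun i => ((hasFDerivAt_apply i x).sub (hasFDerivAt_logSumExp hd x)).exp

theorem continuous_softmaxDeriv (hd : 0 < d) :
    Continuous (softmaxDeriv : (Fin d → ℝ) → (Fin d → ℝ) →L[ℝ] (Fin d → ℝ)) := by
  have h : softmaxDeriv = fderiv ℝ (softmax : (Fin d → ℝ) → Fin d → ℝ) :=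
    funext fun x => (hasFDerivAt_softmax hd x).fderiv.symm
  rw [h]
  exact (contDiff_softmax hd (n := 1)).continuous_fderiv (by norm_num)

theorem logSumExpDeriv_single (x : Fin d → ℝ) (i : Fin d) :
    logSumExpDeriv x (Pi.single i 1) = softmax x i := by
  simp [logSumExpDeriv, Pi.single_apply]

theorem softmax_logPath (hd : 0 < d) {S : ℝ≥0 → Fin d → ℝ} (hS : ∀ t i, 0 < S t i) (t : ℝ≥0) :
    softmax (logPath S t) = marketPortfolio S t := by
  funext i
  simp only [softmax_eq hd, logPath, marketPortfolio, Real.exp_log (hS t _)]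

variable {m : ℕ}

/-- The function of the log-prices `x` and of `a` whose gradient in `x` is the portfolio generated
by `G`. -/
noncomputable def logPotential (G : (Fin d → ℝ) → (Fin m → ℝ) → ℝ) (x : Fin d → ℝ)
    (a : Fin m → ℝ) : ℝ :=
  logSumExp x + Real.log (G (softmax x) a)

variable {V : Set (Fin d → ℝ)} {W : Set (Fin m → ℝ)} {G : (Fin d → ℝ) → (Fin m → ℝ) → ℝ}

theorem partialX_logPotential (hd : 0 < d) (hG : IsC21 V W G) (hV : IsOpen V)
    (hΔ : openSimplex d ⊆ V) (hGpos : ∀ x ∈ V, ∀ a ∈ W, 0 < G x a) (i : Fin d) (x : Fin d → ℝ)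
    {a : Fin m → ℝ} (ha : a ∈ W) :
    partialX i (logPotential G) x a = softmax x i
      + softmax x i * (partialX i G (softmax x) a / G (softmax x) a)
      - ∑ j, softmax x i * softmax x j * (partialX j G (softmax x) a / G (softmax x) a) := by
  have hx := hΔ (softmax_mem_openSimplex hd x)
  have h := (hasFDerivAt_logSumExp hd x).add
    (((hG.hasFDerivAt_left hV hx ha).comp x (hasFDerivAt_softmax hd x)).log (hGpos _ hx a ha).ne')
  have h' : partialX i (logPotential G) x a = _ :=
    congrArg (fun L : (Fin d → ℝ) →L[ℝ] ℝ => L (Pi.single i 1)) h.fderiv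
  rw [h']
  simp only [_root_.add_apply, _root_.smul_apply,
    ContinuousLinearMap.comp_apply, logSumExpDeriv_single]
  rw [clm_apply_eq_sum _ (softmaxDeriv x (Pi.single i 1))]
  have hs : ∀ j, softmaxDeriv x (Pi.single i 1) j =
      (if j = i then softmax x i else 0) - softmax x i * softmax x j := by
    intro j
    simp only [softmaxDeriv, ContinuousLinearMap.pi_apply, _root_.smul_apply,
      _root_.sub_apply, ContinuousLinearMap.proj_apply, logSumExpDeriv_single,
      Pi.single_apply, smul_eq_mul]
    split_ifs with hj
    · rw [hj]; ring
    · ring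
  simp only [hs, sub_mul, Finset.sum_sub_distrib, ite_mul, zero_mul, Finset.sum_ite_eq',
    Finset.mem_univ, if_true, smul_eq_mul, mul_sub, Finset.mul_sum, Function.comp_apply]
  rw [add_sub_assoc]
  congr 1
  congr 1
  · simp only [partialX]; ring
  · exact Finset.sum_congr rfl fun j _ => by simp only [partialX]; ring

theorem isC21_logPotential (hd : 0 < d) (hG : IsC21 V W G) (hV : IsOpen V) (hW : IsOpen W)
    (hΔ : openSimplex d ⊆ V) (hGpos : ∀ x ∈ V, ∀ a ∈ W, 0 < G x a) :
    IsC21 univ W (logPotential G) := by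
  have hmaps : ∀ x, softmax x ∈ V := fun x => hΔ (softmax_mem_openSimplex hd x)
  refine ⟨?_, fun a ha => ?_, fun i j => ?_⟩
  · refine ((contDiff_logSumExp hd).comp contDiff_fst).contDiffOn.add (ContDiffOn.log ?_
      fun p hp => (hGpos _ (hmaps p.1) _ hp.2).ne')
    exact hG.contDiffOn_one.comp
      (((contDiff_softmax hd).comp contDiff_fst).prodMk contDiff_snd).contDiffOn
      fun p hp => ⟨hmaps p.1, hp.2⟩
  · refine (contDiff_logSumExp hd).contDiffOn.add (ContDiffOn.log ?_
      fun x _ => (hGpos _ (hmaps x) a ha).ne')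
    exact (hG.contDiffOn_two a ha).comp (contDiff_softmax hd).contDiffOn fun x _ => hmaps x
  · have hsm : ∀ i, IsPartialC1 univ W fun (x : Fin d → ℝ) (_ : Fin m → ℝ) => softmax x i := by
      intro i
      refine ⟨(((continuous_apply i).comp (contDiff_softmax hd (n := 0)).continuous).comp
        continuous_fst).continuousOn, fun x _ =>
        (ContinuousLinearMap.proj i).comp (softmaxDeriv x), fun x _ a _ => ?_, ?_⟩
      · exact hasFDerivAt_pi'.1 (hasFDerivAt_softmax hd x) i
      · exact ((continuous_const.clm_comp (continuous_softmaxDeriv hd)).comp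
          continuous_fst).continuousOn
    have hlog : ∀ i, IsPartialC1 univ W
        fun x a => partialX i G (softmax x) a / G (softmax x) a := fun i =>
      ((hG.isPartialC1_partialX hV i hW).div (hG.isPartialC1 hV hW)
        fun x hx a ha => (hGpos x hx a ha).ne').comp
        (fun x _ => hasFDerivAt_softmax hd x) (continuous_softmaxDeriv hd).continuousOn
        fun x _ => hmaps x
    refine ((((hsm i).add ((hsm i).mul (hlog i))).sub (IsPartialC1.sum (s := Finset.univ) fun l _ =>
      ((hsm i).mul (hsm l)).mul (hlog l))).continuousOn_partialX j).congr fun p hp => ?_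
    exact congrArg (fun h : (Fin d → ℝ) → ℝ => fderiv ℝ h p.1 (Pi.single j 1))
      (funext fun x => partialX_logPotential hd hG hV hΔ hGpos i x hp.2)

end Softmax

section Portfolio

variable {d m : ℕ} {V : Set (Fin d → ℝ)} {W : Set (Fin m → ℝ)}
  {G : (Fin d → ℝ) → (Fin m → ℝ) → ℝ} {S : ℝ≥0 → Fin d → ℝ} {A : ℝ≥0 → Fin m → ℝ}

theorem marketPortfolio_mem_openSimplex (hd : 0 < d) (hS : ∀ t i, 0 < S t i) (t : ℝ≥0) :
    marketPortfolio S t ∈ openSimplex d :=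
  softmax_logPath hd hS t ▸ softmax_mem_openSimplex hd _

theorem sum_marketPortfolio (hd : 0 < d) (hS : ∀ t i, 0 < S t i) (t : ℝ≥0) :
    ∑ i, marketPortfolio S t i = 1 :=
  (marketPortfolio_mem_openSimplex hd hS t).1.2

theorem sum_generatedPortfolio {μ : ℝ≥0 → Fin d → ℝ} {t : ℝ≥0} (hμ : ∑ i, μ t i = 1) :
    ∑ i, generatedPortfolio G μ A t i = 1 := by
  simp only [generatedPortfolio, Finset.sum_sub_distrib, Finset.sum_add_distrib, hμ]
  rw [Finset.sum_comm]
  simp only [mul_assoc, ← Finset.sum_mul, hμ, one_mul]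
  ring

theorem isPortfolio_generatedPortfolio (hd : 0 < d) (hG : IsC21 V W G) (hV : IsOpen V)
    (hW : IsOpen W) (hΔ : openSimplex d ⊆ V) (hGpos : ∀ x ∈ V, ∀ a ∈ W, 0 < G x a)
    (hS : ∀ t i, 0 < S t i) (hA : Continuous A) (hAW : ∀ t, A t ∈ W)
    (hAbv : ∀ k, LocallyBoundedVariationOn (fun t => A t k) univ) :
    IsPortfolio S (generatedPortfolio G (marketPortfolio S) A) := by
  refine ⟨fun T _ => ⟨m, univ, W, logPotential G, A, isOpen_univ, hW,
    isC21_logPotential hd hG hV hW hΔ hGpos, hA.continuousOn, fun k => ?_,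
    fun t _ => ⟨hAW t, mem_univ _, fun i => ?_⟩⟩,
    fun t => sum_generatedPortfolio (sum_marketPortfolio hd hS t)⟩
  · simpa using hAbv k 0 T trivial trivial
  · have hmem := hΔ (marketPortfolio_mem_openSimplex hd hS t)
    rw [partialX_logPotential hd hG hV hΔ hGpos i _ (hAW t), softmax_logPath hd hS]
    simp only [generatedPortfolio,
      hG.partialX_log hV hmem (hAW t) (hGpos _ hmem _ (hAW t)).ne']

end Portfolio

/-! ### Covariations of the market portfolio -/

theorem exists_norm_le_of_continuous {E : Type*} [SeminormedAddCommGroup E] {φ : ℝ≥0 → E}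
    (hφ : Continuous φ) (T : ℝ≥0) : ∃ M, 0 ≤ M ∧ ∀ t ≤ T, ‖φ t‖ ≤ M := by
  obtain ⟨M, hM⟩ := (isCompact_Icc (a := (0 : ℝ≥0)) (b := T)).exists_bound_of_continuousOn
    hφ.continuousOn
  exact ⟨M, (norm_nonneg _).trans (hM 0 ⟨le_rfl, zero_le⟩), fun t ht => hM t ⟨zero_le, ht⟩⟩

theorem continuous_of_abs_sub_le {g h : ℝ≥0 → ℝ} (hh : Continuous h)
    (hgh : ∀ T, ∃ C, ∀ s t, s ≤ t → t ≤ T → |g t - g s| ≤ C * (h t - h s)) : Continuous g := by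
  refine continuous_iff_continuousAt.2 fun t₀ => ?_
  obtain ⟨C, hC⟩ := hgh (t₀ + 1)
  have hlim : Tendsto (fun t => |C| * |h t - h t₀|) (𝓝 t₀) (𝓝 0) := by
    have h0 : Tendsto h (𝓝 t₀) (𝓝 (h t₀)) := hh.tendsto t₀
    simpa using (h0.sub_const (h t₀)).abs.const_mul |C|
  have hlt : t₀ < t₀ + 1 := lt_add_one _
  rw [ContinuousAt, tendsto_iff_dist_tendsto_zero]
  refine squeeze_zero' (Eventually.of_forall fun _ => dist_nonneg) ?_ hlim
  filter_upwards [eventually_lt_nhds hlt] with t ht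
  rw [Real.dist_eq]
  rcases le_total t₀ t with h1 | h1
  · refine (hC t₀ t h1 ht.le).trans ((le_abs_self _).trans ?_)
    rw [abs_mul]
  · rw [abs_sub_comm, abs_sub_comm (h t)]
    refine (hC t t₀ h1 hlt.le).trans ((le_abs_self _).trans ?_)
    rw [abs_mul]

section Market

variable {d : ℕ} {S : ℝ≥0 → Fin d → ℝ}

/-- The total market capitalization `S₁ + ⋯ + S_d`. -/
noncomputable def totalCap (S : ℝ≥0 → Fin d → ℝ) (t : ℝ≥0) : ℝ := ∑ j, S t j

theorem totalCap_pos (hd : 0 < d) (hS : ∀ t i, 0 < S t i) (t : ℝ≥0) : 0 < totalCap S t :=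
  Finset.sum_pos (fun _ _ => hS t _) ⟨⟨0, hd⟩, Finset.mem_univ _⟩

theorem continuous_totalCap (hS : Continuous S) : Continuous (totalCap S) :=
  continuous_finsetSum _ fun i _ => (continuous_apply i).comp hS

theorem continuous_marketPortfolio (hd : 0 < d) (hS : Continuous S) (hpos : ∀ t i, 0 < S t i) :
    Continuous (marketPortfolio S) :=
  continuous_pi fun i => ((continuous_apply i).comp hS).div (continuous_totalCap hS)
    fun t => (totalCap_pos hd hpos t).ne'

/-- The derivative `∂μ_k/∂S_i`. -/
noncomputable def marketDeriv (S : ℝ≥0 → Fin d → ℝ) (k i : Fin d) (t : ℝ≥0) : ℝ :=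
  ((if k = i then 1 else 0) - marketPortfolio S t k) / totalCap S t

theorem continuous_marketDeriv (hd : 0 < d) (hS : Continuous S) (hpos : ∀ t i, 0 < S t i)
    (k i : Fin d) : Continuous (marketDeriv S k i) :=
  (continuous_const.sub ((continuous_apply k).comp (continuous_marketPortfolio hd hS hpos))).div
    (continuous_totalCap hS) fun t => (totalCap_pos hd hpos t).ne'

theorem sum_marketDeriv_mul (S : ℝ≥0 → Fin d → ℝ) (k : Fin d) (s t : ℝ≥0) :
    ∑ i, marketDeriv S k i s * (S t i - S s i) =
      (S t k - S s k - marketPortfolio S s k * (totalCap S t - totalCap S s)) / totalCap S s := by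
  simp only [marketDeriv, totalCap, div_mul_eq_mul_div, ← Finset.sum_div, sub_mul,
    Finset.sum_sub_distrib, ite_mul, one_mul, zero_mul, Finset.sum_ite_eq, Finset.mem_univ, if_true,
    ← Finset.mul_sum]

/-- The increments of `μ` are exactly those of its linearization, up to the factor by which the
total capitalization changes. -/
theorem marketPortfolio_sub (hd : 0 < d) (hpos : ∀ t i, 0 < S t i) (k : Fin d) (s t : ℝ≥0) :
    marketPortfolio S t k - marketPortfolio S s k =
      (∑ i, marketDeriv S k i s * (S t i - S s i)) * (totalCap S s / totalCap S t) := by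
  have h1 := (totalCap_pos hd hpos s).ne'
  have h2 := (totalCap_pos hd hpos t).ne'
  rw [sum_marketDeriv_mul]
  change S t k / totalCap S t - S s k / totalCap S s =
    (S t k - S s k - S s k / totalCap S s * (totalCap S t - totalCap S s)) / totalCap S s * _
  field_simp
  ring

theorem sum_mul_sum_eq {ι : Type*} [Fintype ι] (a b v : ι → ℝ) :
    (∑ i, a i * v i) * ∑ j, b j * v j = ∑ i, ∑ j, a i * b j * (v i * v j) := by
  rw [Finset.sum_mul_sum]
  exact Finset.sum_congr rfl fun i _ => Finset.sum_congr rfl fun j _ => by ring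

theorem qv_marketPortfolio {P : RefiningPartitions} (hd : 0 < d) (hS : P.QV S)
    (hpos : ∀ t i, 0 < S t i) : P.QV (marketPortfolio S) := by
  have hSc := hS.continuous
  have hσ := totalCap_pos hd hpos
  set c := marketDeriv S with hc_def
  have hc : ∀ k i, Continuous (c k i) := continuous_marketDeriv hd hSc hpos
  set D : ℕ → ℕ → Fin d → ℝ := fun n k i => S (P.point n (k + 1)) i - S (P.point n k) i with hD
  set w : Fin d → Fin d → ℕ → ℕ → ℝ := fun p q n k =>
    (∑ i, c p i (P.point n k) * D n k i) * ∑ j, c q j (P.point n k) * D n k j with hw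
  set e : ℕ → ℕ → ℝ := fun n k =>
    (totalCap S (P.point n k) / totalCap S (P.point n (k + 1))) ^ 2 - 1 with he
  have hprod : ∀ p q n k, (marketPortfolio S (P.point n (k + 1)) p -
      marketPortfolio S (P.point n k) p) * (marketPortfolio S (P.point n (k + 1)) q -
      marketPortfolio S (P.point n k) q) = w p q n k + e n k * w p q n k := by
    intro p q n k
    rw [marketPortfolio_sub hd hpos, marketPortfolio_sub hd hpos]
    simp only [hw, he, hD]
    ring
  have hwb : ∀ T, ∃ C, 0 ≤ C ∧ ∀ p q n, ∀ k ∈ P.index n T, |w p q n k| ≤ C * ∑ i, D n k i ^ 2 := by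
    intro T
    obtain ⟨M, hM0, hM⟩ := exists_norm_le_of_continuous
      (continuous_pi fun k => continuous_pi fun i => hc k i) T
    have hM' : ∀ t ≤ T, ∀ k i, |c k i t| ≤ M := fun t ht k i =>
      ((norm_le_pi_norm (fun i => c k i t) i).trans
        (norm_le_pi_norm (fun k i => c k i t) k)).trans (hM t ht)
    refine ⟨M * M * d, by positivity, fun p q n k hk => ?_⟩
    simp only [hw]
    rw [sum_mul_sum_eq]
    refine abs_sum_sum_mul_le (fun i j => ?_) _
    rw [abs_mul]
    exact mul_le_mul (hM' _ (P.mem_index.1 hk) _ _) (hM' _ (P.mem_index.1 hk) _ _)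
      (abs_nonneg _) hM0
  have hesmall : ∀ T, ∀ ε > 0, ∀ᶠ n in atTop, ∀ k ∈ P.index n T, |e n k| ≤ ε := by
    intro T ε hε
    have hlog : Continuous fun t => Real.log (totalCap S t) :=
      (continuous_totalCap hSc).log fun t => (hσ t).ne'
    have hη : 0 < min (1 / 2) (ε / 4) := by positivity
    filter_upwards [P.eventually_abs_increment_le hlog T hη] with n hn k hk
    have h := hn k hk
    have h1 := h.trans (min_le_left _ _)
    have h2 := h.trans (min_le_right _ _)
    -- `e` is the square of a growth factor minus `1`, and `|exp x - 1| ≤ 2 |x|` for `|x| ≤ 1`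
    have hexp : e n k = Real.exp (-2 * (Real.log (totalCap S (P.point n (k + 1))) -
        Real.log (totalCap S (P.point n k)))) - 1 := by
      rw [show ∀ x y : ℝ, -2 * (x - y) = (y - x) + (y - x) by intros; ring, Real.exp_add,
        Real.exp_sub, Real.exp_log (hσ _), Real.exp_log (hσ _), ← sq]
    rw [hexp]
    refine (Real.abs_exp_sub_one_le ?_).trans ?_
    · rw [abs_mul]; norm_num; linarith
    · rw [abs_mul]; norm_num; linarith
  have hlim : ∀ p q t, Tendsto (fun n => P.covSum (fun s => marketPortfolio S s p)
      (fun s => marketPortfolio S s q) n t) atTop (𝓝 (∑ i, ∑ j,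
        stieltjesIntegral (fun s => c p i s * c q j s)
          (P.covariation (fun s => S s i) (fun s => S s j)) t)) := by
    intro p q T
    have h1 : Tendsto (fun n => ∑ k ∈ P.index n T, w p q n k) atTop (𝓝 (∑ i, ∑ j,
        stieltjesIntegral (fun s => c p i s * c q j s)
          (P.covariation (fun s => S s i) (fun s => S s j)) T)) := by
      refine (hS.tendsto_sum_quadratic (φ := fun i j s => c p i s * c q j s)
        (fun i j => (hc p i).mul (hc q j)) T).congr fun n => ?_
      simp only [hw, sum_mul_sum_eq, hD]
    have h2 : Tendsto (fun n => ∑ k ∈ P.index n T, e n k * w p q n k) atTop (𝓝 0) := by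
      obtain ⟨C, hC0, hC⟩ := hwb T
      refine P.tendsto_sum_zero_of_small (b := fun n k => ∑ i, D n k i ^ 2) (fun ε hε => ?_)
        (hS.eventually_sum_sq_le T)
      have hη : 0 < ε / (C + 1) := by positivity
      filter_upwards [hesmall T _ hη] with n hn k hk
      have hb : 0 ≤ ∑ i, D n k i ^ 2 := Finset.sum_nonneg fun _ _ => sq_nonneg _
      rw [abs_mul]
      calc |e n k| * |w p q n k| ≤ ε / (C + 1) * (C * ∑ i, D n k i ^ 2) :=
            mul_le_mul (hn k hk) (hC p q n k hk) (abs_nonneg _) hη.le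
        _ = ε * (C / (C + 1)) * ∑ i, D n k i ^ 2 := by ring
        _ ≤ ε * 1 * ∑ i, D n k i ^ 2 := by
            gcongr
            exact (div_le_one (by positivity)).2 (by linarith)
        _ = ε * ∑ i, D n k i ^ 2 := by ring
    have h3 := h1.add h2
    rw [add_zero] at h3
    refine h3.congr fun n => ?_
    rw [RefiningPartitions.covSum, ← Finset.sum_add_distrib]
    exact Finset.sum_congr rfl fun k _ => (hprod p q n k).symm
  have hcov : ∀ p q t, Tendsto (fun n => P.covSum (fun s => marketPortfolio S s p)
      (fun s => marketPortfolio S s q) n t) atTop (𝓝 (P.covariation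
        (fun s => marketPortfolio S s p) (fun s => marketPortfolio S s q) t)) := fun p q t =>
    tendsto_nhds_limUnder ⟨_, hlim p q t⟩
  refine ⟨continuous_marketPortfolio hd hSc hpos, fun p q t => ⟨_, hlim p q t⟩, fun p q => ?_⟩
  -- the increments of the covariation of `μ` are dominated by those of the covariations of `S`
  refine continuous_of_abs_sub_le (continuous_finsetSum Finset.univ fun i _ =>
    hS.continuous_covariation i i) fun T => ?_
  obtain ⟨C, hC0, hC⟩ := hwb T
  refine ⟨2 * C, fun s t hst ht => ?_⟩
  have := RefiningPartitions.abs_sub_le_of_tendsto_sum (P := P)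
    (b := fun n k => 2 * C * ∑ i, D n k i ^ 2)
    (h := fun t => 2 * C * ∑ i, P.covariation (fun s => S s i) (fun s => S s i) t)
    hst (hcov p q) (fun u => by
      simp only [← Finset.mul_sum]
      exact (hS.tendsto_sum_sq u).const_mul _) (by
      filter_upwards [hesmall T 1 one_pos] with n hn k hk
      have hk' := P.index_subset n ht hk
      rw [hprod]
      refine (abs_add_le _ _).trans ?_
      rw [abs_mul (e n k)]
      nlinarith [hC p q n k hk', mul_le_mul_of_nonneg_right (hn k hk') (abs_nonneg (w p q n k))])
  rwa [mul_sub]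

end Market

/-! ### The value of a generated portfolio -/

section LogSums

variable {P : RefiningPartitions} {T : ℝ≥0}

/-- The expansion `log (1 + u) = u - u² / 2 + o(u²)`, summed over the partition intervals. -/
theorem tendsto_sum_log_one_add {u : ℕ → ℕ → ℝ}
    (hu : ∀ ε > 0, ∀ᶠ n in atTop, ∀ k ∈ P.index n T, |u n k| ≤ ε)
    (hb : ∃ C : ℝ, ∀ᶠ n in atTop, ∑ k ∈ P.index n T, u n k ^ 2 ≤ C) :
    Tendsto (fun n => ∑ k ∈ P.index n T, (Real.log (1 + u n k) - u n k + u n k ^ 2 / 2)) atTop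
      (𝓝 0) := by
  refine P.tendsto_sum_zero_of_small (b := fun n k => u n k ^ 2) (fun ε hε => ?_) hb
  filter_upwards [hu (min (1 / 2) (ε / 2)) (by positivity)] with n hn k hk
  have h1 := (hn k hk).trans (min_le_left _ _)
  have h2 := (hn k hk).trans (min_le_right _ _)
  have h := Real.abs_log_sub_add_sum_range_le (x := -u n k) (by rw [abs_neg]; linarith) 2
  rw [abs_neg] at h
  calc _ = |∑ i ∈ Finset.range 2, (-u n k) ^ (i + 1) / (i + 1) + Real.log (1 - -u n k)| := by
        simp only [Finset.sum_range_succ, Finset.sum_range_zero]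
        rw [sub_neg_eq_add]
        congr 1
        push_cast
        ring
    _ ≤ |u n k| ^ (2 + 1) / (1 - |u n k|) := h
    _ ≤ |u n k| ^ (2 + 1) / (1 / 2) := by gcongr; linarith
    _ = (2 * |u n k|) * u n k ^ 2 := by rw [← sq_abs (u n k)]; ring
    _ ≤ ε * u n k ^ 2 := by gcongr; linarith

/-- Small perturbations enter `log` near `1` linearly, as its derivative at `1` is `1`. -/
theorem tendsto_sum_log_add_sub_log {u v : ℕ → ℕ → ℝ}
    (hu : ∀ ε > 0, ∀ᶠ n in atTop, ∀ k ∈ P.index n T, |u n k| ≤ ε)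
    (hv : ∀ ε > 0, ∀ᶠ n in atTop, ∀ k ∈ P.index n T, |v n k| ≤ ε)
    (hb : ∃ C : ℝ, ∀ᶠ n in atTop, ∑ k ∈ P.index n T, |v n k - u n k| ≤ C) :
    Tendsto (fun n => ∑ k ∈ P.index n T, (Real.log (1 + v n k) - Real.log (1 + u n k) -
      (v n k - u n k))) atTop (𝓝 0) := by
  refine P.tendsto_sum_zero_of_small (b := fun n k => |v n k - u n k|) (fun ε hε => ?_) hb
  have h := (Real.hasStrictDerivAt_log one_ne_zero).hasStrictFDerivAt.isLittleO.bound hε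
  rw [Metric.eventually_nhds_iff] at h
  obtain ⟨δ, hδ, h⟩ := h
  filter_upwards [hu (δ / 2) (by positivity), hv (δ / 2) (by positivity)] with n h1 h2 k hk
  have := h (y := (1 + v n k, 1 + u n k)) (by
    rw [Prod.dist_eq]
    refine max_lt ?_ ?_ <;> rw [Real.dist_eq, add_sub_cancel_left]
    · linarith [h2 k hk]
    · linarith [h1 k hk])
  simpa [Real.norm_eq_abs] using this

theorem eventually_abs_sum_mul_increment_le {d : ℕ} (P : RefiningPartitions)
    {φ Y : ℝ≥0 → Fin d → ℝ} (hφ : Continuous φ) (hY : Continuous Y) (T : ℝ≥0) :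
    ∀ ε > 0, ∀ᶠ n in atTop, ∀ k ∈ P.index n T,
      |∑ i, φ (P.point n k) i * (Y (P.point n (k + 1)) i - Y (P.point n k) i)| ≤ ε := by
  intro ε hε
  obtain ⟨M, hM0, hM⟩ := exists_norm_le_of_continuous hφ T
  have hη : 0 < ε / (d * M + 1) := by positivity
  filter_upwards [P.eventually_dist_le hY T hη] with n hn k hk
  have h1 := hM _ (P.mem_index.1 hk)
  have h2 := hn k hk _ (right_mem_Icc.2 (P.point_le_succ n k))
  calc _ ≤ ∑ i, |φ (P.point n k) i * (Y (P.point n (k + 1)) i - Y (P.point n k) i)| :=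
        Finset.abs_sum_le_sum_abs _ _
    _ ≤ ∑ _i : Fin d, M * (ε / (d * M + 1)) := by
        refine Finset.sum_le_sum fun i _ => ?_
        rw [abs_mul, ← Real.dist_eq]
        exact mul_le_mul ((norm_le_pi_norm _ i).trans h1) ((dist_le_pi_dist _ _ i).trans h2)
          dist_nonneg hM0
    _ = ε * ((d * M) / (d * M + 1)) := by
        rw [Finset.sum_const, Finset.card_univ, Fintype.card_fin, nsmul_eq_mul]
        ring
    _ ≤ ε * 1 := by
        gcongr
        exact (div_le_one (by positivity)).2 (by linarith)
    _ = ε := mul_one ε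

end LogSums

section

variable {d m : ℕ} {P : RefiningPartitions} {V : Set (Fin d → ℝ)} {W : Set (Fin m → ℝ)}
  {G : (Fin d → ℝ) → (Fin m → ℝ) → ℝ} {X : ℝ≥0 → Fin d → ℝ} {A : ℝ≥0 → Fin m → ℝ}

/-- With `γ = ∑ᵢ (G_{x_i} / G) ΔXᵢ`, the sums of `log (1 + γ)` converge: they differ from the
telescoping sums of the increments of `log G(X, A)` by the second-order terms in `X` and the
first-order terms in `A` of the expansion of `G`. -/
theorem tendsto_sum_log_one_add_gradient (hX : P.QV X) (hG : IsC21 V W G) (hV : IsOpen V)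
    (hW : IsOpen W) (hGpos : ∀ x ∈ V, ∀ a ∈ W, 0 < G x a) (hXV : ∀ t, X t ∈ V)
    (hA : Continuous A) (hAW : ∀ t, A t ∈ W)
    (hAbv : ∀ k, LocallyBoundedVariationOn (fun t => A t k) univ) (T : ℝ≥0) :
    Tendsto (fun n => ∑ k ∈ P.index n T, Real.log (1 + ∑ i,
      partialX i G (X (P.point n k)) (A (P.point n k)) / G (X (P.point n k)) (A (P.point n k)) *
        (X (P.point n (k + 1)) i - X (P.point n k) i))) atTop
      (𝓝 (Real.log (G (X T) (A T) / G (X 0) (A 0))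
        + (-(1 / 2) * ∑ i, ∑ j, stieltjesIntegral
            (fun t => partialX j (partialX i G) (X t) (A t) / G (X t) (A t))
            (P.covariation (fun s => X s i) (fun s => X s j)) T)
        + (-∑ k, stieltjesIntegral (fun t => partialA k G (X t) (A t) / G (X t) (A t))
            (fun s => A s k) T))) := by
  have hXA : Continuous fun t => (X t, A t) := hX.continuous.prodMk hA
  have hmem : ∀ t, (X t, A t) ∈ V ×ˢ W := fun t => ⟨hXV t, hAW t⟩
  set Γ : ℝ≥0 → ℝ := fun t => G (X t) (A t) with hΓ_def
  have hΓ : Continuous Γ := hG.continuousOn.comp_continuous hXA hmem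
  have hΓpos : ∀ t, 0 < Γ t := fun t => hGpos _ (hXV t) _ (hAW t)
  have hΓ0 : ∀ t, Γ t ≠ 0 := fun t => (hΓpos t).ne'
  set g : ℝ≥0 → Fin d → ℝ := fun t i => partialX i G (X t) (A t) / Γ t with hg_def
  have hg : Continuous g := continuous_pi fun i =>
    ((hG.continuousOn_partialX hV hW i).comp_continuous hXA hmem).div hΓ hΓ0
  set H : Fin d → Fin d → ℝ≥0 → ℝ := fun i j t =>
    partialX j (partialX i G) (X t) (A t) / Γ t with hH_def
  have hH : ∀ i j, Continuous (H i j) := fun i j =>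
    ((hG.continuousOn_second i j).comp_continuous hXA hmem).div hΓ hΓ0
  set ζ : Fin m → ℝ≥0 → ℝ := fun l t => partialA l G (X t) (A t) / Γ t with hζ_def
  have hζ : ∀ l, Continuous (ζ l) := fun l =>
    ((hG.continuousOn_partialA hV hW l).comp_continuous hXA hmem).div hΓ hΓ0
  have hAk : ∀ l, Continuous fun t => A t l := fun l => (continuous_apply l).comp hA
  set D : ℕ → ℕ → Fin d → ℝ := fun n k i => X (P.point n (k + 1)) i - X (P.point n k) i with hD
  set B : ℕ → ℕ → Fin m → ℝ := fun n k l => A (P.point n (k + 1)) l - A (P.point n k) l with hB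
  set b : ℕ → ℕ → ℝ := fun n k => ∑ i, D n k i ^ 2 + ∑ l, |B n k l| with hb_def
  have hb0 : ∀ n k, 0 ≤ b n k := fun n k => add_nonneg (Finset.sum_nonneg fun _ _ => sq_nonneg _)
    (Finset.sum_nonneg fun _ _ => abs_nonneg _)
  -- `v` is the relative increment of `G(X, A)`, and `γ`, `q / 2 + z` and `R` are its leading term,
  -- its drift term and its remainder
  set R : ℕ → ℕ → ℝ := fun n k => IsC21.remainder G (X (P.point n k)) (A (P.point n k))
    (X (P.point n (k + 1))) (A (P.point n (k + 1))) / Γ (P.point n k) with hR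
  set γ : ℕ → ℕ → ℝ := fun n k => ∑ i, g (P.point n k) i * D n k i with hγ
  set v : ℕ → ℕ → ℝ := fun n k =>
    (Γ (P.point n k))⁻¹ * (Γ (P.point n (k + 1)) - Γ (P.point n k)) with hv
  set q : ℕ → ℕ → ℝ := fun n k => ∑ i, ∑ j, H i j (P.point n k) * (D n k i * D n k j) with hq
  set z : ℕ → ℕ → ℝ := fun n k => ∑ l, ζ l (P.point n k) * B n k l with hz
  have hexp : ∀ n k, v n k - γ n k = 1 / 2 * q n k + z n k + R n k := by
    intro n k
    have h0 := hΓ0 (P.point n k)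
    simp only [hv, hγ, hq, hz, hR, hg_def, hH_def, hζ_def, IsC21.remainder, hD, hB,
      div_mul_eq_mul_div, ← Finset.sum_div]
    field_simp
    ring
  -- the sums of the terms that control the errors are bounded
  have hbsum : ∃ C : ℝ, ∀ᶠ n in atTop, ∑ k ∈ P.index n T, b n k ≤ C := by
    obtain ⟨C, hC⟩ := hX.eventually_sum_sq_le T
    choose C' hC' using fun l => P.eventually_sum_abs_increment_le (hAbv l) T
    refine ⟨C + ∑ l, C' l, ?_⟩
    filter_upwards [hC, eventually_all.2 hC'] with n h1 h2
    simp only [hb_def, Finset.sum_add_distrib]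
    rw [Finset.sum_comm (s := P.index n T) (t := (Finset.univ : Finset (Fin m)))]
    exact add_le_add h1 (Finset.sum_le_sum fun l _ => h2 l)
  have hRsmall : ∀ ε > 0, ∀ᶠ n in atTop, ∀ k ∈ P.index n T, |R n k| ≤ ε * b n k := by
    intro ε hε
    obtain ⟨M, hM0, hM⟩ := exists_norm_le_of_continuous (hΓ.inv₀ hΓ0) T
    have hη : 0 < ε / (M + 1) := by positivity
    filter_upwards [hG.eventually_abs_remainder_le hV hW P hX.continuous hA hXV hAW T hη]
      with n hn k hk
    simp only [hR]
    rw [div_eq_mul_inv, abs_mul]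
    calc _ ≤ (ε / (M + 1) * b n k) * M :=
          mul_le_mul (hn k hk) (hM _ (P.mem_index.1 hk)) (abs_nonneg _)
            (mul_nonneg hη.le (hb0 n k))
      _ = ε * (M / (M + 1)) * b n k := by ring
      _ ≤ ε * 1 * b n k := by
          have := hb0 n k
          gcongr
          exact (div_le_one (by positivity)).2 (by linarith)
      _ = ε * b n k := by ring
  have hγsmall : ∀ ε > 0, ∀ᶠ n in atTop, ∀ k ∈ P.index n T, |γ n k| ≤ ε :=
    eventually_abs_sum_mul_increment_le P hg hX.continuous T
  have hvsmall : ∀ ε > 0, ∀ᶠ n in atTop, ∀ k ∈ P.index n T, |v n k| ≤ ε := by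
    have := eventually_abs_sum_mul_increment_le P (d := 1) (φ := fun t _ => (Γ t)⁻¹)
      (Y := fun t _ => Γ t) (continuous_pi fun _ => hΓ.inv₀ hΓ0) (continuous_pi fun _ => hΓ) T
    simpa only [Finset.univ_unique, Finset.sum_singleton] using this
  have hdiff : ∃ C : ℝ, ∀ᶠ n in atTop, ∑ k ∈ P.index n T, |v n k - γ n k| ≤ C := by
    obtain ⟨C, hC⟩ := hbsum
    obtain ⟨M, hM0, hM⟩ := exists_norm_le_of_continuous
      (continuous_pi fun i => continuous_pi fun j => hH i j) T
    obtain ⟨M', hM0', hM'⟩ := exists_norm_le_of_continuous (continuous_pi hζ) T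
    refine ⟨(M * d + M' + 1) * C, ?_⟩
    filter_upwards [hC, hRsmall 1 one_pos] with n h1 h2
    calc ∑ k ∈ P.index n T, |v n k - γ n k| ≤ ∑ k ∈ P.index n T, (M * d + M' + 1) * b n k := by
          refine Finset.sum_le_sum fun k hk => ?_
          have hk' := P.mem_index.1 hk
          have hq' : |q n k| ≤ M * d * ∑ i, D n k i ^ 2 := abs_sum_sum_mul_le (fun i j =>
            ((norm_le_pi_norm (fun j => H i j (P.point n k)) j).trans
              (norm_le_pi_norm (fun i j => H i j (P.point n k)) i)).trans (hM _ hk')) _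
          have hz' : |z n k| ≤ M' * ∑ l, |B n k l| := by
            rw [Finset.mul_sum]
            refine (Finset.abs_sum_le_sum_abs _ _).trans (Finset.sum_le_sum fun l _ => ?_)
            rw [abs_mul]
            exact mul_le_mul_of_nonneg_right
              ((norm_le_pi_norm (fun l => ζ l (P.point n k)) l).trans (hM' _ hk')) (abs_nonneg _)
          have hs : 0 ≤ ∑ i, D n k i ^ 2 := Finset.sum_nonneg fun _ _ => sq_nonneg _
          have hl : 0 ≤ ∑ l, |B n k l| := Finset.sum_nonneg fun _ _ => abs_nonneg _
          have hMd : 0 ≤ M * d := by positivity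
          have hR' := h2 k hk
          rw [hexp]
          have habs : |1 / 2 * q n k + z n k + R n k| ≤ 1 / 2 * |q n k| + |z n k| + |R n k| := by
            refine (abs_add_le _ _).trans (add_le_add_left ((abs_add_le _ _).trans ?_) _)
            rw [abs_mul]
            norm_num
          have hb' : b n k = ∑ i, D n k i ^ 2 + ∑ l, |B n k l| := rfl
          rw [hb'] at hR' ⊢
          nlinarith [abs_nonneg (q n k), mul_nonneg hMd hl, mul_nonneg hM0' hs]
      _ = (M * d + M' + 1) * ∑ k ∈ P.index n T, b n k := by rw [Finset.mul_sum]
      _ ≤ (M * d + M' + 1) * C := by gcongr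
  have hlogΓ := P.tendsto_sum_increment (hΓ.log hΓ0) T
  have hQ := (hX.tendsto_sum_quadratic hH T).const_mul (1 / 2)
  have hZ : Tendsto (fun n => ∑ k ∈ P.index n T, z n k) atTop
      (𝓝 (∑ l, stieltjesIntegral (ζ l) (fun s => A s l) T)) := by
    refine (tendsto_finsetSum Finset.univ fun l _ => P.tendsto_sum_mul_increment (hAk l) (hAbv l)
      (hζ l) T).congr fun n => ?_
    exact Finset.sum_comm
  have hR0 : Tendsto (fun n => ∑ k ∈ P.index n T, R n k) atTop (𝓝 0) :=
    P.tendsto_sum_zero_of_small hRsmall hbsum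
  have hlog := tendsto_sum_log_add_sub_log hγsmall hvsmall hdiff
  have htot := (((hlogΓ.sub hlog).sub hQ).sub hZ).sub hR0
  rw [Real.log_div (hΓ0 T) (hΓ0 0)]
  convert htot using 1
  · funext n
    rw [Finset.mul_sum, ← Finset.sum_sub_distrib, ← Finset.sum_sub_distrib,
      ← Finset.sum_sub_distrib, ← Finset.sum_sub_distrib]
    refine Finset.sum_congr rfl fun k _ => ?_
    have h1 : 1 + v n k = Γ (P.point n (k + 1)) / Γ (P.point n k) := by
      have := hΓ0 (P.point n k)
      simp only [hv]
      field_simp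
      ring
    have h2 := hexp n k
    rw [h1, Real.log_div (hΓ0 _) (hΓ0 _), h2]
    simp only [hγ, hq]
    ring
  · congr 1
    simp only [hH_def, hζ_def, hΓ_def]
    ring

end

section

variable {d m : ℕ} {P : RefiningPartitions} {V : Set (Fin d → ℝ)} {W : Set (Fin m → ℝ)}
  {G : (Fin d → ℝ) → (Fin m → ℝ) → ℝ} {S : ℝ≥0 → Fin d → ℝ} {A : ℝ≥0 → Fin m → ℝ}

/-- On each partition interval the growth factor of the generated portfolio is the product of that
of the market and of `1 + ∑ₖ (G_{x_k} / G) Δμₖ`. -/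
theorem one_add_sum_generatedPortfolio (hd : 0 < d) (hpos : ∀ t i, 0 < S t i)
    {μ : ℝ≥0 → Fin d → ℝ} (hμ : μ = marketPortfolio S) (s t : ℝ≥0) :
    1 + ∑ i, generatedPortfolio G μ A s i / S s i * (S t i - S s i) =
      totalCap S t / totalCap S s *
        (1 + ∑ k, partialX k (fun x a => Real.log (G x a)) (μ s) (A s) * (μ t k - μ s k)) := by
  set g := fun k => partialX k (fun x a => Real.log (G x a)) (μ s) (A s) with hg
  have hs := (totalCap_pos hd hpos s).ne'
  have ht := (totalCap_pos hd hpos t).ne'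
  change _ = totalCap S t / totalCap S s * (1 + ∑ k, g k * (μ t k - μ s k))
  set c := ∑ j, μ s j * g j with hc
  have h1 : ∀ i, generatedPortfolio G μ A s i / S s i * (S t i - S s i) =
      (1 - c) / totalCap S s * (S t i - S s i) + g i * (S t i - S s i) / totalCap S s := by
    intro i
    have hSi := (hpos s i).ne'
    have hgen : generatedPortfolio G μ A s i = μ s i * (1 + g i - c) := by
      simp only [generatedPortfolio, mul_assoc, ← Finset.mul_sum, hc, hg]
      ring
    have hμi : μ s i = S s i / totalCap S s := by rw [hμ]; rfl
    rw [hgen, hμi]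
    field_simp
    ring
  have h2 : ∀ k, totalCap S t / totalCap S s * (g k * (μ t k - μ s k)) =
      g k * (S t k - S s k) / totalCap S s -
        (μ s k * g k) * ((totalCap S t - totalCap S s) / totalCap S s) := by
    intro k
    have hμt : μ t k = S t k / totalCap S t := by rw [hμ]; rfl
    have hμs : μ s k = S s k / totalCap S s := by rw [hμ]; rfl
    rw [hμt, hμs]
    field_simp
    ring
  have h3 : ∑ i, (S t i - S s i) = totalCap S t - totalCap S s := Finset.sum_sub_distrib _ _
  simp only [h1]
  rw [Finset.sum_add_distrib, ← Finset.mul_sum, h3, mul_add, Finset.mul_sum]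
  simp only [h2]
  rw [Finset.sum_sub_distrib, ← Finset.sum_mul, ← hc]
  field_simp
  ring

theorem continuous_generatedPortfolio (hG : IsC21 V W G) (hV : IsOpen V) (hW : IsOpen W)
    (hGpos : ∀ x ∈ V, ∀ a ∈ W, 0 < G x a) {μ : ℝ≥0 → Fin d → ℝ} (hμ : Continuous μ)
    (hμV : ∀ t, μ t ∈ V) (hA : Continuous A) (hAW : ∀ t, A t ∈ W) :
    Continuous (generatedPortfolio G μ A) := by
  have hmem : ∀ t, (μ t, A t) ∈ V ×ˢ W := fun t => ⟨hμV t, hAW t⟩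
  have hg : ∀ i, Continuous fun t => partialX i (fun x a => Real.log (G x a)) (μ t) (A t) := by
    intro i
    have h := ((hG.continuousOn_partialX hV hW i).comp_continuous (hμ.prodMk hA) hmem).div
      (hG.continuousOn.comp_continuous (hμ.prodMk hA) hmem)
      fun t => (hGpos _ (hμV t) _ (hAW t)).ne'
    refine h.congr fun t => ?_
    exact (hG.partialX_log hV (hμV t) (hAW t) (hGpos _ (hμV t) _ (hAW t)).ne' i).symm
  have hμi : ∀ i, Continuous fun t => μ t i := fun i => (continuous_apply i).comp hμ
  refine continuous_pi fun i => ?_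
  exact ((hμi i).add ((hμi i).mul (hg i))).sub
    (continuous_finsetSum _ fun j _ => ((hμi i).mul (hμi j)).mul (hg j))

/-- The Föllmer integral in the value of the portfolio generated by `G` exists. The sums of the
logarithms of the growth factors converge, and they differ from the sums in the Föllmer integral
by half the quadratic variation, up to a vanishing error. -/
theorem tendsto_follmerSum_generatedPortfolio (hd : 0 < d) (hS : P.QV S)
    (hpos : ∀ t i, 0 < S t i) (hG : IsC21 V W G) (hV : IsOpen V) (hW : IsOpen W)
    (hΔ : openSimplex d ⊆ V) (hGpos : ∀ x ∈ V, ∀ a ∈ W, 0 < G x a)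
    (hA : Continuous A) (hAW : ∀ t, A t ∈ W)
    (hAbv : ∀ k, LocallyBoundedVariationOn (fun t => A t k) univ)
    {μ π : ℝ≥0 → Fin d → ℝ} (hμ : μ = marketPortfolio S) (hπ : π = generatedPortfolio G μ A)
    (T : ℝ≥0) :
    Tendsto (fun n => P.follmerSum (fun s i => π s i / S s i) S n T) atTop
      (𝓝 (Real.log (totalCap S T / totalCap S 0)
        + (Real.log (G (μ T) (A T) / G (μ 0) (A 0))
        + (-(1 / 2) * ∑ i, ∑ j, stieltjesIntegral
            (fun t => partialX j (partialX i G) (μ t) (A t) / G (μ t) (A t))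
            (P.covariation (fun s => μ s i) (fun s => μ s j)) T)
        + (-∑ k, stieltjesIntegral (fun t => partialA k G (μ t) (A t) / G (μ t) (A t))
            (fun s => A s k) T))
        + 1 / 2 * ∑ i, ∑ j, stieltjesIntegral (fun s => π s i * π s j / (S s i * S s j))
            (P.covariation (fun s => S s i) (fun s => S s j)) T)) := by
  have hσ := totalCap_pos hd hpos
  have hμQ : P.QV μ := hμ ▸ qv_marketPortfolio hd hS hpos
  have hμV : ∀ t, μ t ∈ V := fun t => hμ ▸ hΔ (marketPortfolio_mem_openSimplex hd hpos t)
  have hπc : Continuous π :=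
    hπ ▸ continuous_generatedPortfolio hG hV hW hGpos hμQ.continuous hμV hA hAW
  set φ : ℝ≥0 → Fin d → ℝ := fun s i => π s i / S s i with hφ_def
  have hφ : ∀ i, Continuous fun s => φ s i := fun i =>
    ((continuous_apply i).comp hπc).div (hS.continuous_apply i) fun t => (hpos t i).ne'
  set u : ℕ → ℕ → ℝ := fun n k =>
    ∑ i, φ (P.point n k) i * (S (P.point n (k + 1)) i - S (P.point n k) i) with hu
  set γ : ℕ → ℕ → ℝ := fun n k => ∑ i, partialX i G (μ (P.point n k)) (A (P.point n k)) /
    G (μ (P.point n k)) (A (P.point n k)) * (μ (P.point n (k + 1)) i - μ (P.point n k) i) with hγ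
  have hprod : ∀ n k, 1 + u n k =
      totalCap S (P.point n (k + 1)) / totalCap S (P.point n k) * (1 + γ n k) := by
    intro n k
    have h := one_add_sum_generatedPortfolio (G := G) (A := A) hd hpos hμ (P.point n k)
      (P.point n (k + 1))
    simp only [hG.partialX_log hV (hμV _) (hAW _) (hGpos _ (hμV _) _ (hAW _)).ne'] at h
    rw [← hπ] at h
    exact h
  have husmall : ∀ ε > 0, ∀ᶠ n in atTop, ∀ k ∈ P.index n T, |u n k| ≤ ε :=
    eventually_abs_sum_mul_increment_le P (continuous_pi hφ) hS.continuous T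
  have hu2 : Tendsto (fun n => ∑ k ∈ P.index n T, u n k ^ 2) atTop (𝓝 (∑ i, ∑ j,
      stieltjesIntegral (fun s => π s i * π s j / (S s i * S s j))
        (P.covariation (fun s => S s i) (fun s => S s j)) T)) := by
    have h := hS.tendsto_sum_quadratic (φ := fun i j s => φ s i * φ s j)
      (fun i j => (hφ i).mul (hφ j)) T
    simp only [hφ_def, div_mul_div_comm] at h
    refine h.congr fun n => Finset.sum_congr rfl fun k _ => ?_
    rw [sq, hu]
    simp only [sum_mul_sum_eq, hφ_def, div_mul_div_comm]
  have h0 := tendsto_sum_log_one_add husmall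
    ⟨_, hu2.eventually_le_const (lt_add_one _)⟩
  have hσlog := P.tendsto_sum_increment ((continuous_totalCap hS.continuous).log
    fun t => (hσ t).ne') T
  have hγlog := tendsto_sum_log_one_add_gradient hμQ hG hV hW hGpos hμV hA hAW hAbv T
  rw [← Real.log_div (hσ T).ne' (hσ 0).ne'] at hσlog
  have htot := ((hσlog.add hγlog).add (hu2.const_mul (1 / 2))).sub h0
  rw [sub_zero] at htot
  refine htot.congr' ?_
  filter_upwards [husmall (1 / 2) (by norm_num)] with n hn
  rw [Finset.mul_sum, ← Finset.sum_add_distrib, ← Finset.sum_add_distrib,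
    ← Finset.sum_sub_distrib, RefiningPartitions.follmerSum]
  refine Finset.sum_congr rfl fun k hk => ?_
  have hu0 : 0 < 1 + u n k := by
    have := (abs_le.1 (hn k hk)).1
    linarith
  have h1 := hprod n k
  have hγ0 : 1 + γ n k ≠ 0 := by
    intro h
    rw [h, mul_zero] at h1
    exact hu0.ne' h1
  have h2 : Real.log (1 + u n k) = Real.log (totalCap S (P.point n (k + 1))) -
      Real.log (totalCap S (P.point n k)) + Real.log (1 + γ n k) := by
    rw [h1, Real.log_mul (div_pos (hσ _) (hσ _)).ne' hγ0, Real.log_div (hσ _).ne' (hσ _).ne']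
  change _ + Real.log (1 + γ n k) + 1 / 2 * u n k ^ 2 - _ = u n k
  rw [h2]
  ring

theorem valueWellDefined_generatedPortfolio (r : ℝ≥0 → ℝ) (hd : 0 < d) (hS : P.QV S)
    (hpos : ∀ t i, 0 < S t i) (hG : IsC21 V W G) (hV : IsOpen V) (hW : IsOpen W)
    (hΔ : openSimplex d ⊆ V) (hGpos : ∀ x ∈ V, ∀ a ∈ W, 0 < G x a)
    (hA : Continuous A) (hAW : ∀ t, A t ∈ W)
    (hAbv : ∀ k, LocallyBoundedVariationOn (fun t => A t k) univ)
    {μ π : ℝ≥0 → Fin d → ℝ} (hμ : μ = marketPortfolio S) (hπ : π = generatedPortfolio G μ A) :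
    ValueWellDefined P r S π := by
  have hμc : Continuous μ := hμ ▸ continuous_marketPortfolio hd hS.continuous hpos
  have hμV : ∀ t, μ t ∈ V := fun t => hμ ▸ hΔ (marketPortfolio_mem_openSimplex hd hpos t)
  have hπc : Continuous π := hπ ▸ continuous_generatedPortfolio hG hV hW hGpos hμc hμV hA hAW
  have hπi : ∀ i, Continuous fun s => π s i := fun i => (continuous_apply i).comp hπc
  have hsum : ∀ t, ∑ i, π t i = 1 := fun t => by
    rw [hπ]
    exact sum_generatedPortfolio (hμ ▸ sum_marketPortfolio hd hpos t)
  refine ⟨fun t => ⟨_, tendsto_follmerSum_generatedPortfolio hd hS hpos hG hV hW hΔ hGpos hA hAW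
    hAbv hμ hπ t⟩, fun i j => hS.stieltjesIntegrable i j ?_, fun t => ?_⟩
  · exact ((hπi i).mul (hπi j)).div ((hS.continuous_apply i).mul (hS.continuous_apply j))
      fun t => (mul_pos (hpos t i) (hpos t j)).ne'
  · simp [hsum]

/-- The master equation relative to cash instead of to the market portfolio. -/
theorem log_portfolioValue_generatedPortfolio (r : ℝ≥0 → ℝ) (hd : 0 < d) (hS : P.QV S)
    (hpos : ∀ t i, 0 < S t i) (hG : IsC21 V W G) (hV : IsOpen V) (hW : IsOpen W)
    (hΔ : openSimplex d ⊆ V) (hGpos : ∀ x ∈ V, ∀ a ∈ W, 0 < G x a)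
    (hA : Continuous A) (hAW : ∀ t, A t ∈ W)
    (hAbv : ∀ k, LocallyBoundedVariationOn (fun t => A t k) univ)
    {μ π : ℝ≥0 → Fin d → ℝ} (hμ : μ = marketPortfolio S) (hπ : π = generatedPortfolio G μ A)
    (T : ℝ≥0) :
    Real.log (portfolioValue P r S π T) =
      Real.log (totalCap S T / totalCap S 0)
        + (Real.log (G (μ T) (A T) / G (μ 0) (A 0))
        + (-(1 / 2) * ∑ i, ∑ j, stieltjesIntegral
            (fun t => partialX j (partialX i G) (μ t) (A t) / G (μ t) (A t))
            (P.covariation (fun s => μ s i) (fun s => μ s j)) T)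
        + (-∑ k, stieltjesIntegral (fun t => partialA k G (μ t) (A t) / G (μ t) (A t))
            (fun s => A s k) T)) := by
  have hsum : ∀ t, ∑ i, π t i = 1 := fun t => by
    rw [hπ]
    exact sum_generatedPortfolio (hμ ▸ sum_marketPortfolio hd hpos t)
  have h := (tendsto_follmerSum_generatedPortfolio hd hS hpos hG hV hW hΔ hGpos hA hAW
    hAbv hμ hπ T).limUnder_eq
  rw [portfolioValue, Real.log_exp, RefiningPartitions.follmerIntegral, h]
  simp only [hsum, sub_self, zero_mul, intervalIntegral.integral_zero]
  ring

end

/-! ### The market portfolio as a generated portfolio -/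

section

variable {d m : ℕ}

theorem isC21_const (U : Set (Fin d → ℝ)) (V : Set (Fin m → ℝ)) (c : ℝ) :
    IsC21 U V fun _ _ => c := by
  refine ⟨contDiffOn_const, fun _ _ => contDiffOn_const, fun i j => ?_⟩
  simp only [partialX, fderiv_fun_const, Pi.zero_apply, zero_apply]
  exact continuousOn_const

theorem generatedPortfolio_const (c : ℝ) (μ : ℝ≥0 → Fin d → ℝ) (A : ℝ≥0 → Fin m → ℝ) :
    generatedPortfolio (fun _ _ => c) μ A = μ := by
  funext t i
  simp [generatedPortfolio, partialX]

theorem stieltjesIntegral_zero (g : ℝ≥0 → ℝ) (T : ℝ≥0) :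
    stieltjesIntegral (fun _ => 0) g T = 0 :=
  VectorMeasure.integral_zero

end

end FollmerSPT

theorem theorem2p9 {d m : ℕ} (hd : 0 < d)
    -- the fixed refining sequence of partitions
    (P : FollmerSPT.RefiningPartitions)
    -- the short rate
    (r : ℝ≥0 → ℝ) (hr : Measurable r)
    (hrint : ∀ T : ℝ≥0, IntervalIntegrable (fun s : ℝ => r s.toNNReal) volume 0 T)
    -- the price path, in `QV_+^d`
    (S : ℝ≥0 → Fin d → ℝ) (hS : P.QV S) (hSpos : ∀ t i, 0 < S t i)
    -- the generating function
    (V : Set (Fin d → ℝ)) (W : Set (Fin m → ℝ)) (hV : IsOpen V) (hW : IsOpen W)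
    (hΔ : FollmerSPT.openSimplex d ⊆ V)
    (G : (Fin d → ℝ) → (Fin m → ℝ) → ℝ) (hG : FollmerSPT.IsC21 V W G)
    (hGpos : ∀ x ∈ V, ∀ a ∈ W, 0 < G x a)
    -- the additional continuous path of locally finite variation
    (A : ℝ≥0 → Fin m → ℝ) (hA : Continuous A) (hAW : ∀ t, A t ∈ W)
    (hAbv : ∀ k, LocallyBoundedVariationOn (fun t => A t k) univ)
    -- the market portfolio and the portfolio generated by `G`
    (μ π : ℝ≥0 → Fin d → ℝ) (hμ : μ = FollmerSPT.marketPortfolio S)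
    (hπ : π = FollmerSPT.generatedPortfolio G μ A) :
    -- `μ` and `π` are portfolios with well-defined values
    FollmerSPT.IsPortfolio S μ ∧ FollmerSPT.ValueWellDefined P r S μ ∧
    FollmerSPT.IsPortfolio S π ∧ FollmerSPT.ValueWellDefined P r S π ∧
    -- the covariations of `μ` exist, and the signed Radon measures in the two drift terms make sense
    P.QV μ ∧
    (∀ i j, FollmerSPT.StieltjesIntegrable
      (fun t => FollmerSPT.partialX j (FollmerSPT.partialX i G) (μ t) (A t) / G (μ t) (A t))
      (P.covariation (fun s => μ s i) (fun s => μ s j))) ∧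
    (∀ k, FollmerSPT.StieltjesIntegrable
      (fun t => FollmerSPT.partialA k G (μ t) (A t) / G (μ t) (A t)) (fun s => A s k)) ∧
    -- the master equation
    ∀ T : ℝ≥0,
      Real.log (FollmerSPT.portfolioValue P r S π T / FollmerSPT.portfolioValue P r S μ T) =
        Real.log (G (μ T) (A T) / G (μ 0) (A 0))
        + (-(1 / 2) * ∑ i, ∑ j, FollmerSPT.stieltjesIntegral
            (fun t => FollmerSPT.partialX j (FollmerSPT.partialX i G) (μ t) (A t) / G (μ t) (A t))
            (P.covariation (fun s => μ s i) (fun s => μ s j)) T)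
        + (-∑ k, FollmerSPT.stieltjesIntegral
            (fun t => FollmerSPT.partialA k G (μ t) (A t) / G (μ t) (A t)) (fun s => A s k) T) := by
  open FollmerSPT in
  have hμQ : P.QV μ := hμ ▸ qv_marketPortfolio hd hS hSpos
  have hμV : ∀ t, μ t ∈ V := fun t => hμ ▸ hΔ (marketPortfolio_mem_openSimplex hd hSpos t)
  have hμA : Continuous fun t => (μ t, A t) := hμQ.continuous.prodMk hA
  have hmem : ∀ t, (μ t, A t) ∈ V ×ˢ W := fun t => ⟨hμV t, hAW t⟩
  have hΓ : Continuous fun t => G (μ t) (A t) := hG.continuousOn.comp_continuous hμA hmem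
  have hΓ0 : ∀ t, G (μ t) (A t) ≠ 0 := fun t => (hGpos _ (hμV t) _ (hAW t)).ne'
  -- the constant function `1` generates the market portfolio
  have h1 : IsC21 V W fun _ _ => 1 := isC21_const V W 1
  have h1pos : ∀ x ∈ V, ∀ a ∈ W, (0 : ℝ) < (fun _ _ => 1 : (Fin d → ℝ) → (Fin m → ℝ) → ℝ) x a :=
    fun _ _ _ _ => one_pos
  have hμ1 : μ = generatedPortfolio (fun _ _ => 1) μ A := (generatedPortfolio_const 1 μ A).symm
  refine ⟨?_, ?_, ?_, ?_, hμQ, fun i j => ?_, fun k => ?_, fun T => ?_⟩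
  · rw [hμ1, hμ]
    exact isPortfolio_generatedPortfolio hd h1 hV hW hΔ h1pos hSpos hA hAW hAbv
  · exact valueWellDefined_generatedPortfolio r hd hS hSpos h1 hV hW hΔ h1pos hA hAW hAbv hμ hμ1
  · rw [hπ, hμ]
    exact isPortfolio_generatedPortfolio hd hG hV hW hΔ hGpos hSpos hA hAW hAbv
  · exact valueWellDefined_generatedPortfolio r hd hS hSpos hG hV hW hΔ hGpos hA hAW hAbv hμ hπ
  · exact hμQ.stieltjesIntegrable i j
      (((hG.continuousOn_second i j).comp_continuous hμA hmem).div hΓ hΓ0)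
  · exact .of_continuous (((hG.continuousOn_partialA hV hW k).comp_continuous hμA hmem).div hΓ hΓ0)
      ((continuous_apply k).comp hA) (hAbv k)
  · have hvalμ := log_portfolioValue_generatedPortfolio r hd hS hSpos h1 hV hW hΔ h1pos hA hAW hAbv
      hμ hμ1 T
    have hvalπ := log_portfolioValue_generatedPortfolio r hd hS hSpos hG hV hW hΔ hGpos hA hAW hAbv
      hμ hπ T
    simp only [partialX, partialA, fderiv_fun_const, Pi.zero_apply, zero_apply,
      stieltjesIntegral_zero, Finset.sum_const_zero, div_one, Real.log_one, mul_zero, neg_zero,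
      add_zero] at hvalμ
    have hpos : ∀ ρ, portfolioValue P r S ρ T ≠ 0 := fun ρ => (Real.exp_pos _).ne'
    rw [Real.log_div (hpos π) (hpos μ), hvalπ, hvalμ]
    ring
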